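/- Let $r,T>0$, $X=\mathbb R\times L^2([-r,0];\mathbb R)$ with $\langle x,y\rangle=x_0y_0+\int_{-r}^0x_1y_1\,d\xi$, $a_0\le 0$, $b_0\ge 0$, $\sigma\in\mathbb R$, $a_1\in L^2([-r,0];\mathbb R)$, $b_1\in L^2([-r,0];\mathbb R_+)$, and $\beta,\gamma>0$. Let $$A(x_0,x_1)=(a_0x_0+x_1(0),\,a_1x_0-x_1'),\qquad D(A)=\{x\in X:\ x_1\in W^{1,2}([-r,0]),\ x_1(-r)=0\},$$ $$A^*(x_0,x_1)=\Big(a_0x_0+\int_{-r}^0a_1x_1\,d\xi,\ x_1'\Big),\qquad D(A^*)=\{x\in X:\ x_1\in W^{1,2}([-r,0]),\ x_0=x_1(0)\},$$ $B=(b_0,b_1)\in X$, $G:\mathbb R\to X$, $Gy=(\sigma y,0)$, $Q=GG^*$, $h(z)=-\beta z^2$, $\varphi(x)=\gamma x_0$. Let $W_0$ be a real Brownian motion on a probability space, $\mathbb F$ its completed filtration, and $\mathcal U$ the set of non-negative progressively measurable square integrable processes on $[0,T]$. For $z\in\mathcal U$, $t\in[0,T]$, $x\in X$ let $Y(\cdot;t,x,z)$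 be the weak solution with continuous paths on $[t,T]$ of $dY=(AY+Bz)\,ds+G\,dW_0$, $Y(t)=x$ (i.e. $Y$ is adapted and, for all $\zeta\in D(A^*)$ and $s\in[t,T]$, a.s. $\langle Y(s),\zeta\rangle=\langle x,\zeta\rangle+\int_t^s(\langle Y,A^*\zeta\rangle+\langle Bz,\zeta\rangle)\,d\tau+\langle G(W_0(s)-W_0(t)),\zeta\rangle$). Let $$J(t,x;z)=\mathbb E\Big[\varphi(Y(T;t,x,z))+\int_t^Th(z(s))\,ds\Big],\qquad V(t,x)=\sup_{z\in\mathcal U}J(t,x;z),$$ and call $z^*\in\mathcal U$ optimal at $(t,x)$ if $V(t,x)=J(t,x;z^*)$. Put $H_0(p)=\sup_{z\ge 0}(\langle Bz,p\rangle+h(z))$. An integral solution of the HJB equation $v_t+\frac12\mathrm{Tr}(Qv_{xx})+\langle Ax,v_x\rangle+H_0(v_x)=0$, $v(T)=\varphi$, is a function $v\in C^{0,2}([0,T]\times X)$ such that for all $t\in[0,T]$, $x\in D(A)$ $$\varphi(x)-v(t,x)+\int_t^T\Big[\tfrac12\mathrm{Tr}(Qv_{xx}(s,x))+\langle Ax,v_x(s,x)\rangle+H_0(v_x(s,x))\Big]ds=0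 .$$ Then the following hold. 1. For every $p\in X$, $H_0(p)=(\langle B,p\rangle^+)^2/(4\beta)$, and the supremum is attained at $z=\langle B,p\rangle^+/(2\beta)$. 2. For every $t\in[0,T]$, $x\in X$ and $z\in\mathcal U$ the weak solution $Y(\cdot;t,x,z)$ exists, is unique up to indistinguishability, and $\varphi(Y(T))+\int_t^Th(z(s))\,ds$ is integrable; so $J$ is well defined. 3. There is a unique continuous $w:[0,T]\to X$ with $w'+A^*w=0$, $w(T)=(\gamma,0)$ in the weak sense that $\frac{d}{dt}\langle w(t),x\rangle+\langle w(t),Ax\rangle=0$ on $[0,T]$ for all $x\in D(A)$. It satisfies $w_0'(t)+a_0w_0(t)+\int_{-r}^0a_1(\xi)w_1(t,\xi)\,d\xi=0$ and, for a.e. $\xi\in[-r,0]$, $w_1(t,\xi)=w_0(t-\xi)\mathbf 1_{\{t-\xi\in[0,T]\}}$, for every $t\in[0,T]$. There is $c:[0,T]\to\mathbb R$ with $c'(t)=-(\langle B,w(t)\rangle^+)^2/(4\beta)$ on $[0,T]$ and $c(T)=0$. 4. With these $w$ and $c$, the function $v(t,x)=\langle w(t),x\rangle+c(t)$ is an integral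 solution of the HJB equation. 5. The open-loop control $z^*(t)=\langle B,w(t)\rangle^+/(2\beta)$ belongs to $\mathcal U$ and is optimal at every starting point $(t,x)\in[0,T]\times X$, and $v=V$ on $[0,T]\times X$. -/

import Mathlib

open MeasureTheory ProbabilityTheory Set
open scoped NNReal ENNReal InnerProductSpace

noncomputable section

namespace DelayControl

/-! ### The state space and the delay operators -/

/-- `L²([-r,0];ℝ)`. -/
abbrev L2 (r : ℝ) : Type := Lp ℝ 2 ((volume : Measure ℝ).restrict (Icc (-r) 0))

/-- The Hilbert space `X = ℝ × L²([-r,0];ℝ)` with the `ℓ²` product structure. -/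
abbrev X (r : ℝ) : Type := WithLp 2 (ℝ × L2 r)

/-- `f` belongs to `W^{1,2}([-r,0])`, with absolutely continuous representative `F` on `[-r,0]`
and derivative `f' = g ∈ L²([-r,0])`. -/
def IsW12 {r : ℝ} (f g : L2 r) (F : ℝ → ℝ) : Prop :=
  (∀ᵐ ξ ∂(volume.restrict (Icc (-r) 0)), f ξ = F ξ) ∧
    ∀ ξ ∈ Icc (-r) 0, F ξ = F (-r) + ∫ u in (-r)..ξ, g u

lemma L2.intervalIntegrable {r : ℝ} (g : L2 r) {ξ : ℝ} (hξ : ξ ∈ Icc (-r) 0) :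
    IntervalIntegrable g volume (-r) ξ := by
  have h : IntegrableOn g (Icc (-r) 0) volume := (Lp.memLp g).integrable (by norm_num)
  rw [intervalIntegrable_iff, uIoc_of_le hξ.1]
  exact h.mono_set (fun u hu => ⟨hu.1.le, hu.2.trans hξ.2⟩)

lemma IsW12.add {r : ℝ} {f g f' g' : L2 r} {F F' : ℝ → ℝ} (h : IsW12 f g F)
    (h' : IsW12 f' g' F') : IsW12 (f + f') (g + g') (fun ξ => F ξ + F' ξ) := by
  refine ⟨?_, fun ξ hξ => ?_⟩
  · filter_upwards [h.1, h'.1, Lp.coeFn_add f f'] with ξ h1 h2 h3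
    rw [h3, Pi.add_apply, h1, h2]
  · have e : ∫ u in (-r)..ξ, (g + g' : L2 r) u = ∫ u in (-r)..ξ, (g u + g' u) := by
      rw [intervalIntegral.integral_of_le hξ.1, intervalIntegral.integral_of_le hξ.1]
      refine integral_congr_ae ?_
      exact ae_restrict_of_ae_restrict_of_subset
        (Ioc_subset_Icc_self.trans (Icc_subset_Icc_right hξ.2)) (Lp.coeFn_add g g')
    rw [e, intervalIntegral.integral_add (g.intervalIntegrable hξ) (g'.intervalIntegrable hξ)]
    change F ξ + F' ξ = F (-r) + F' (-r) + _
    rw [h.2 ξ hξ, h'.2 ξ hξ]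
    ring

lemma IsW12.smul {r : ℝ} {f g : L2 r} {F : ℝ → ℝ} (c : ℝ) (h : IsW12 f g F) :
    IsW12 (c • f) (c • g) (fun ξ => c * F ξ) := by
  refine ⟨?_, fun ξ hξ => ?_⟩
  · filter_upwards [h.1, Lp.coeFn_smul c f] with ξ h1 h3
    rw [h3, Pi.smul_apply, h1, smul_eq_mul]
  · have e : ∫ u in (-r)..ξ, (c • g : L2 r) u = ∫ u in (-r)..ξ, c * g u := by
      rw [intervalIntegral.integral_of_le hξ.1, intervalIntegral.integral_of_le hξ.1]
      refine integral_congr_ae ?_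
      exact ae_restrict_of_ae_restrict_of_subset
        (Ioc_subset_Icc_self.trans (Icc_subset_Icc_right hξ.2)) (Lp.coeFn_smul c g)
    rw [e, intervalIntegral.integral_const_mul]
    change c * F ξ = c * F (-r) + _
    rw [h.2 ξ hξ]
    ring

lemma IsW12.zero (r : ℝ) : IsW12 (0 : L2 r) 0 (fun _ => 0) := by
  refine ⟨?_, fun ξ hξ => ?_⟩
  · filter_upwards [Lp.coeFn_zero ℝ 2 (volume.restrict (Icc (-r) 0))] with ξ h
    simpa using h
  · rw [intervalIntegral.integral_of_le hξ.1]
    have : ∀ᵐ u ∂(volume.restrict (Ioc (-r) ξ)), (0 : L2 r) u = 0 :=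
      ae_restrict_of_ae_restrict_of_subset
        (Ioc_subset_Icc_self.trans (Icc_subset_Icc_right hξ.2)) (Lp.coeFn_zero ℝ 2 (volume.restrict (Icc (-r) 0)))
    rw [integral_congr_ae this]
    simp

/-- The representative and the derivative are determined by the function. -/
lemma IsW12.eq_zero {r : ℝ} (hr : 0 < r) {g : L2 r} {F : ℝ → ℝ} (h : IsW12 0 g F) :
    (∀ ξ ∈ Icc (-r) 0, F ξ = 0) ∧ g = 0 := by
  have hr0 : (-r) ≤ 0 := by linarith
  have hg : IntervalIntegrable g volume (-r) 0 := g.intervalIntegrable ⟨hr0, le_rfl⟩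
  have hc : ContinuousOn F (Icc (-r) 0) := by
    have h1 : ContinuousOn (fun ξ => F (-r) + ∫ u in (-r)..ξ, g u) (Icc (-r) 0) := by
      refine continuousOn_const.add ?_
      have := intervalIntegral.continuousOn_primitive_interval (f := g) (μ := volume)
        (a := -r) (b := 0) (by rw [uIcc_of_le hr0]; exact (Lp.memLp g).integrable (by norm_num))
      rwa [uIcc_of_le hr0] at this
    exact h1.congr h.2
  have h0 : F =ᵐ[volume.restrict (Icc (-r) 0)] fun _ => (0 : ℝ) := by
    filter_upwards [h.1, Lp.coeFn_zero ℝ 2 (volume.restrict (Icc (-r) 0))] with ξ h1 h2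
    rw [← h1, h2]; rfl
  have hF : EqOn F (fun _ => (0 : ℝ)) (Icc (-r) 0) :=
    Measure.eqOn_Icc_of_ae_eq volume (by linarith : (-r) ≠ 0) h0 hc continuousOn_const
  refine ⟨hF, ?_⟩
  have hI : ∀ ξ ∈ Icc (-r) 0, ∫ u in (-r)..ξ, g u = 0 := fun ξ hξ => by
    have := h.2 ξ hξ
    rw [hF hξ, hF (left_mem_Icc.2 hr0)] at this
    simpa using this.symm
  have hd := hg.ae_hasDerivAt_integral
  have hne1 : ∀ᵐ x : ℝ, x ≠ -r := by simp [ae_iff, measure_singleton]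
  have hne2 : ∀ᵐ x : ℝ, x ≠ 0 := by simp [ae_iff, measure_singleton]
  refine Lp.ext ?_
  have key : ∀ᵐ x ∂(volume.restrict (Icc (-r) 0)), g x = 0 := by
    rw [ae_restrict_iff' measurableSet_Icc]
    filter_upwards [hd, hne1, hne2] with x hx h1 h2 hxI
    have hx' : x ∈ Ioo (-r) 0 := ⟨lt_of_le_of_ne hxI.1 (Ne.symm h1), lt_of_le_of_ne hxI.2 h2⟩
    have d1 := hx (by rwa [uIcc_of_le hr0]) (-r) (by rw [uIcc_of_le hr0]; exact left_mem_Icc.2 hr0)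
    have d2 : HasDerivAt (fun x => ∫ u in (-r)..x, g u) 0 x := by
      refine (hasDerivAt_const x (0 : ℝ)).congr_of_eventuallyEq ?_
      filter_upwards [Ioo_mem_nhds hx'.1 hx'.2] with y hy
      exact hI y ⟨hy.1.le, hy.2.le⟩
    exact d1.unique d2
  filter_upwards [key, Lp.coeFn_zero ℝ 2 (volume.restrict (Icc (-r) 0))] with x h1 h2
  rw [h1, h2]; rfl

/-- The graph of `A (x₀, x₁) = (a₀ x₀ + x₁(0), a₁ x₀ - x₁')` on
`D(A) = {x₁ ∈ W^{1,2}([-r,0]), x₁(-r) = 0}`. -/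
def graphA (r a₀ : ℝ) (a₁ : L2 r) : Submodule ℝ (X r × X r) where
  carrier := {p | ∃ (F : ℝ → ℝ) (g : L2 r), IsW12 p.1.snd g F ∧ F (-r) = 0 ∧
    p.2.fst = a₀ * p.1.fst + F 0 ∧ p.2.snd = p.1.fst • a₁ - g}
  add_mem' := by
    rintro p q ⟨F, g, h1, h2, h3, h4⟩ ⟨F', g', h1', h2', h3', h4'⟩
    refine ⟨fun ξ => F ξ + F' ξ, g + g', h1.add h1', by simp [h2, h2'], ?_, ?_⟩
    · change p.2.fst + q.2.fst = a₀ * (p.1.fst + q.1.fst) + (F 0 + F' 0)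
      rw [h3, h3']; ring
    · change p.2.snd + q.2.snd = (p.1.fst + q.1.fst) • a₁ - (g + g')
      rw [h4, h4', add_smul]; abel
  zero_mem' := by
    refine ⟨fun _ => 0, 0, IsW12.zero r, rfl, ?_, ?_⟩
    · change (0 : ℝ) = a₀ * 0 + 0
      simp
    · change (0 : L2 r) = (0 : ℝ) • a₁ - 0
      simp
  smul_mem' := by
    rintro c p ⟨F, g, h1, h2, h3, h4⟩
    refine ⟨fun ξ => c * F ξ, c • g, h1.smul c, by simp [h2], ?_, ?_⟩
    · change c * p.2.fst = a₀ * (c * p.1.fst) + c * F 0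
      rw [h3]; ring
    · change c • p.2.snd = (c * p.1.fst) • a₁ - c • g
      rw [h4, smul_sub, smul_smul]

/-- The graph of `A* (x₀, x₁) = (a₀ x₀ + ∫ a₁ x₁, x₁')` on
`D(A*) = {x₁ ∈ W^{1,2}([-r,0]), x₁(0) = x₀}`; the integral is the `L²` inner product. -/
def graphAstar (r a₀ : ℝ) (a₁ : L2 r) : Submodule ℝ (X r × X r) where
  carrier := {p | ∃ F : ℝ → ℝ, IsW12 p.1.snd p.2.snd F ∧ p.1.fst = F 0 ∧
    p.2.fst = a₀ * p.1.fst + ⟪a₁, p.1.snd⟫_ℝ}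
  add_mem' := by
    rintro p q ⟨F, h1, h2, h3⟩ ⟨F', h1', h2', h3'⟩
    refine ⟨fun ξ => F ξ + F' ξ, h1.add h1', ?_, ?_⟩
    · change p.1.fst + q.1.fst = F 0 + F' 0
      rw [h2, h2']
    · change p.2.fst + q.2.fst = a₀ * (p.1.fst + q.1.fst) + ⟪a₁, p.1.snd + q.1.snd⟫_ℝ
      rw [h3, h3', inner_add_right]; ring
  zero_mem' := by
    refine ⟨fun _ => 0, IsW12.zero r, rfl, ?_⟩
    change (0 : ℝ) = a₀ * 0 + ⟪a₁, (0 : L2 r)⟫_ℝ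
    simp
  smul_mem' := by
    rintro c p ⟨F, h1, h2, h3⟩
    refine ⟨fun ξ => c * F ξ, h1.smul c, ?_, ?_⟩
    · change c * p.1.fst = c * F 0
      rw [h2]
    · change c * p.2.fst = a₀ * (c * p.1.fst) + ⟪a₁, c • p.1.snd⟫_ℝ
      rw [h3, inner_smul_right]; ring

/-- The unbounded operator `A : D(A) ⊂ X → X`. -/
def opA (r a₀ : ℝ) (a₁ : L2 r) : X r →ₗ.[ℝ] X r := (graphA r a₀ a₁).toLinearPMap

/-- The unbounded operator `A* : D(A*) ⊂ X → X`. -/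
def opAstar (r a₀ : ℝ) (a₁ : L2 r) : X r →ₗ.[ℝ] X r := (graphAstar r a₀ a₁).toLinearPMap

lemma X_ext {r : ℝ} {x y : X r} (h0 : x.fst = y.fst) (h1 : x.snd = y.snd) : x = y :=
  WithLp.ofLp_injective 2 (Prod.ext h0 h1)

theorem opA_graph {r : ℝ} (hr : 0 < r) (a₀ : ℝ) (a₁ : L2 r) :
    (opA r a₀ a₁).graph = graphA r a₀ a₁ := by
  refine Submodule.toLinearPMap_graph_eq _ ?_
  rintro ⟨x, y⟩ ⟨F, g, h1, -, h3, h4⟩ (rfl : x = 0)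
  obtain ⟨hF, rfl⟩ := IsW12.eq_zero hr h1
  have h5 := hF 0 ⟨by linarith, le_rfl⟩
  refine X_ext ?_ ?_
  · change y.fst = a₀ * 0 + F 0 at h3
    change y.fst = 0
    rw [h3, h5]; simp
  · change y.snd = (0 : ℝ) • a₁ - 0 at h4
    change y.snd = 0
    rw [h4]; simp

theorem opAstar_graph {r : ℝ} (hr : 0 < r) (a₀ : ℝ) (a₁ : L2 r) :
    (opAstar r a₀ a₁).graph = graphAstar r a₀ a₁ := by
  refine Submodule.toLinearPMap_graph_eq _ ?_
  rintro ⟨x, y⟩ ⟨F, h1, -, h3⟩ (rfl : x = 0)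
  refine X_ext ?_ ?_
  · change y.fst = a₀ * 0 + ⟪a₁, (0 : L2 r)⟫_ℝ at h3
    change y.fst = 0
    rw [h3]; simp
  · exact (IsW12.eq_zero hr h1).2

/-- The noise operator `G : ℝ → X`, `G x₀ = (σ x₀, 0)`. -/
def opG (r σ : ℝ) : ℝ →L[ℝ] X r :=
  ContinuousLinearMap.toSpanSingleton ℝ (WithLp.toLp 2 (σ, (0 : L2 r)))

/-- `Q = G G*`, i.e. `Q (x₀, x₁) = (σ² x₀, 0)`. -/
def opQ (r σ : ℝ) : X r →L[ℝ] X r := (opG r σ) ∘L (opG r σ).adjoint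

/-! ### The Hamilton-Jacobi-Bellman equation -/

section HJB

variable {E : Type*} [NormedAddCommGroup E] [InnerProductSpace ℝ E] [CompleteSpace E]

/-- A Hilbert basis of `E`. -/
def someHilbertBasis (E : Type*) [NormedAddCommGroup E] [InnerProductSpace ℝ E]
    [CompleteSpace E] : HilbertBasis (exists_hilbertBasis ℝ E).choose ℝ E :=
  (exists_hilbertBasis ℝ E).choose_spec.choose

/-- The trace `∑ᵢ ⟨S eᵢ, eᵢ⟩` along a Hilbert basis (independent of the basis when `S` is of
trace class; it is applied to operators `Q v_xx` with `Q` of rank at most one). -/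
def trace (S : E →L[ℝ] E) : ℝ :=
  ∑' i, ⟪S (someHilbertBasis E i), someHilbertBasis E i⟫_ℝ

/-- `v_x(t,x)`. -/
def grad (v : ℝ → E → ℝ) (t : ℝ) (x : E) : E := gradient (v t) x

/-- `v_xx(t,x)`. -/
def hess (v : ℝ → E → ℝ) (t : ℝ) (x : E) : E →L[ℝ] E := fderiv ℝ (grad v t) x

/-- The class `C^{0,2}([0,T] × E)`. -/
structure IsC02 (T : ℝ) (v : ℝ → E → ℝ) : Prop where
  contDiff : ∀ t ∈ Icc 0 T, ContDiff ℝ 2 (v t)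
  continuousOn : ContinuousOn (fun p : ℝ × E => v p.1 p.2) (Icc 0 T ×ˢ univ)
  continuousOn_grad : ContinuousOn (fun p : ℝ × E => grad v p.1 p.2) (Icc 0 T ×ˢ univ)
  continuousOn_hess : ContinuousOn (fun p : ℝ × E => hess v p.1 p.2) (Icc 0 T ×ˢ univ)

/-- The values `⟨Bz, p⟩ + h(z)`, `z ∈ U = ℝ₊`, of the current-value Hamiltonian. -/
def hamiltonianValues (B : E) (h : ℝ → ℝ) (p : E) : Set ℝ :=
  (fun z : ℝ => ⟪z • B, p⟫_ℝ + h z) '' Ici 0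

/-- `H₀(p) = sup_{z ∈ ℝ₊} (⟨Bz, p⟩ + h(z))`. -/
def hamiltonian (B : E) (h : ℝ → ℝ) (p : E) : ℝ := sSup (hamiltonianValues B h p)

/-- The integrand of the integrated HJB equation at `x ∈ D(A)`. -/
def hjbIntegrand (A : E →ₗ.[ℝ] E) (Q : E →L[ℝ] E) (H₀ : E → ℝ) (v : ℝ → E → ℝ)
    (x : A.domain) (s : ℝ) : ℝ :=
  (1 / 2) * trace (Q ∘L hess v s x) + ⟪A x, grad v s x⟫_ℝ + H₀ (grad v s x)

/-- `v` is an integral solution on `[0,T]` of the HJB equation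
`v_t + ½ Tr(Q v_xx) + ⟨Ax, v_x⟩ + H₀(v_x) = 0`, `v(T) = φ`. -/
structure IsIntegralSolution (A : E →ₗ.[ℝ] E) (Q : E →L[ℝ] E) (H₀ : E → ℝ) (φ : E → ℝ)
    (T : ℝ) (v : ℝ → E → ℝ) : Prop where
  isC02 : IsC02 T v
  intervalIntegrable : ∀ t ∈ Icc 0 T, ∀ x : A.domain,
    IntervalIntegrable (hjbIntegrand A Q H₀ v x) volume t T
  eq_zero : ∀ t ∈ Icc 0 T, ∀ x : A.domain,
    φ x - v t x + ∫ s in t..T, hjbIntegrand A Q H₀ v x s = 0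

/-- `w` is a (weak) solution on `[0,T]` of `w' + A* w = 0`, `w(T) = wT`: it is continuous, and
`⟨w'(t), x⟩ + ⟨w(t), A x⟩ = 0` for every `x ∈ D(A)`. (The values `w(t)` need not lie in
`D(A*)`.) -/
structure IsAdjointSolution (A : E →ₗ.[ℝ] E) (T : ℝ) (wT : E) (w : ℝ → E) : Prop where
  continuousOn : ContinuousOn w (Icc 0 T)
  hasDeriv : ∀ x : A.domain, ∀ t ∈ Icc 0 T,
    HasDerivWithinAt (fun s => ⟪w s, (x : E)⟫_ℝ) (-⟪w t, A x⟫_ℝ) (Icc 0 T) t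
  terminal : w T = wT

end HJB

/-! ### The stochastic control problem -/

section Control

variable {Ω : Type*} {mΩ : MeasurableSpace Ω}

/-- The `P`-completion of a filtration (by all `P`-null events of the ambient σ-algebra). -/
def completion (P : Measure Ω) (f : Filtration ℝ≥0 mΩ) : Filtration ℝ≥0 mΩ where
  seq s := f s ⊔ MeasurableSpace.generateFrom {N | MeasurableSet N ∧ P N = 0}
  mono' _ _ hst := sup_le_sup_right (f.mono hst) _
  le' s := sup_le (f.le s) (MeasurableSpace.generateFrom_le fun _ hN => hN.1)

/-- The completed filtration generated by the process `W`. -/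
def brownianFiltration (P : Measure Ω) (W : ℝ≥0 → Ω → ℝ) (hW : ∀ s, Measurable (W s)) :
    Filtration ℝ≥0 mΩ :=
  completion P (Filtration.natural W fun s => (hW s).stronglyMeasurable)

/-- The class `𝒰 = L²_𝔽([0,T];ℝ₊)` of admissible controls. -/
structure IsAdmissible (P : Measure Ω) (𝔽 : Filtration ℝ≥0 mΩ) (T : ℝ) (z : ℝ → Ω → ℝ) :
    Prop where
  progressive : ∀ s ∈ Icc 0 T,
    Measurable[(inferInstance : MeasurableSpace (Icc (0 : ℝ) s)).prod (𝔽 s.toNNReal)]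
      (fun p : Icc (0 : ℝ) s × Ω => z p.1 p.2)
  nonneg : ∀ s ∈ Icc 0 T, ∀ ω, 0 ≤ z s ω
  memLp : MemLp (fun p : ℝ × Ω => z p.1 p.2) 2 ((volume.restrict (Icc 0 T)).prod P)

variable {E : Type*} [NormedAddCommGroup E] [InnerProductSpace ℝ E]

/-- `Y` is a weak solution with continuous paths on `[t,T]` of
`dY(s) = (A Y(s) + B z(s)) ds + G dW(s)`, `Y(t) = x`; `Astar` is the adjoint of `A`. -/
structure IsWeakSolution (P : Measure Ω) (𝔽 : Filtration ℝ≥0 mΩ) (W : ℝ≥0 → Ω → ℝ)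
    (Astar : E →ₗ.[ℝ] E) (B : E) (G : ℝ →L[ℝ] E) (T t : ℝ) (x : E) (z : ℝ → Ω → ℝ)
    (Y : ℝ → Ω → E) : Prop where
  adapted : ∀ s ∈ Icc t T, StronglyMeasurable[𝔽 s.toNNReal] (Y s)
  continuousOn : ∀ᵐ ω ∂P, ContinuousOn (fun s => Y s ω) (Icc t T)
  eq : ∀ ζ : Astar.domain, ∀ s ∈ Icc t T, ∀ᵐ ω ∂P,
    ⟪Y s ω, (ζ : E)⟫_ℝ = ⟪x, (ζ : E)⟫_ℝ
      + (∫ τ in t..s, (⟪Y τ ω, Astar ζ⟫_ℝ + ⟪z τ ω • B, (ζ : E)⟫_ℝ))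
      + ⟪G (W s.toNNReal ω - W t.toNNReal ω), (ζ : E)⟫_ℝ

/-- The random payoff `φ(Y(T)) + ∫_t^T h(z(s)) ds`. -/
def payoff (φ : E → ℝ) (h : ℝ → ℝ) (T t : ℝ) (z : ℝ → Ω → ℝ) (Y : ℝ → Ω → E) (ω : Ω) : ℝ :=
  φ (Y T ω) + ∫ s in t..T, h (z s ω)

open Classical in
/-- The objective `J(t,x;z) = 𝔼[φ(Y(T;t,x,z)) + ∫_t^T h(z(s)) ds]`, where `Y(·;t,x,z)` is the weak
solution of the state equation. -/
def J (P : Measure Ω) (𝔽 : Filtration ℝ≥0 mΩ) (W : ℝ≥0 → Ω → ℝ) (Astar : E →ₗ.[ℝ] E) (B : E)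
    (G : ℝ →L[ℝ] E) (φ : E → ℝ) (h : ℝ → ℝ) (T t : ℝ) (x : E) (z : ℝ → Ω → ℝ) : ℝ :=
  if hY : ∃ Y, IsWeakSolution P 𝔽 W Astar B G T t x z Y then
    ∫ ω, payoff φ h T t z hY.choose ω ∂P
  else 0

/-- The value function `V(t,x) = sup_{z ∈ 𝒰} J(t,x;z)`. -/
def V (P : Measure Ω) (𝔽 : Filtration ℝ≥0 mΩ) (W : ℝ≥0 → Ω → ℝ) (Astar : E →ₗ.[ℝ] E) (B : E)
    (G : ℝ →L[ℝ] E) (φ : E → ℝ) (h : ℝ → ℝ) (T t : ℝ) (x : E) : EReal :=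
  ⨆ (z : ℝ → Ω → ℝ) (_ : IsAdmissible P 𝔽 T z),
    ((J P 𝔽 W Astar B G φ h T t x z : ℝ) : EReal)

/-- `z` is an optimal control at the starting point `(t,x)`: it is admissible and
`V(t,x) = J(t,x;z)`. -/
def IsOptimal (P : Measure Ω) (𝔽 : Filtration ℝ≥0 mΩ) (W : ℝ≥0 → Ω → ℝ) (Astar : E →ₗ.[ℝ] E)
    (B : E) (G : ℝ →L[ℝ] E) (φ : E → ℝ) (h : ℝ → ℝ) (T t : ℝ) (x : E) (z : ℝ → Ω → ℝ) : Prop :=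
  IsAdmissible P 𝔽 T z ∧
    V P 𝔽 W Astar B G φ h T t x = ((J P 𝔽 W Astar B G φ h T t x z : ℝ) : EReal)

end Control

end DelayControl

end

/-!
The head `Y₀` of the state solves a scalar delay equation with additive noise, so the dynamics
reduce to one deterministic scalar Volterra equation, solved by `exists_volterra_solution`.

**The semigroup.** `A` is the generator of translation with absorption at the head (`shiftFlow`)
perturbed by the rank one operator `x ↦ x₀ (a₀, a₁)`. Let `p` be the solution of `p = 1 + κ * p`,
`κ(s) = a₀ + ∫_{-s}^0 a₁`, and `q(s) = (p(s), p(s + ·))` its path of segments (`segmentFlow`). The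
head of the solution `u_x` of `u' = A u`, `u(0) = x`, is `⟨q(s), x⟩`: both sides solve the same
Volterra equation (`IsFundamental.inner_segmentFlow_eq`, `fst_delayFlow`). Hence `u_x` is given by
variation of constants (`delayFlow`), and `w(t) = γ q(T - t)` (`adjointFlow`) is dual to it,
`⟨u_x(s), (γ, 0)⟩ = ⟨w(T - s), x⟩`. The same identities give the weak equation
`w' + A* w = 0`, the delay equation of `w₀` and the formula for `w₁`.

**The state equation.** The noise acts in the direction `(σ, 0) ∈ D(A)`, so the stochastic
convolution can be integrated by parts, and the solution is pathwise an explicit convolution of the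
control and of the Brownian path with solutions of the homogeneous equation (`mildPath`). No
stochastic integral is needed. Adaptedness uses a modification of the Brownian path on a null event,
which the completed filtration permits.

**Uniqueness.** The time integral `M` of a weak solution `D` of the homogeneous equation satisfies
`⟨D, ζ⟩ = ⟨M, A*ζ⟩` on `D(A*)`, hence `M ∈ D(A)` and `M' = A M`. Integration by parts shows that `A`
is quasi-dissipative, so `M = 0` by Gronwall's argument (`eq_zero_of_weak_homogeneous`). The same
argument with `A` and `A*` exchanged gives the uniqueness of `w`.

**Optimality.** By duality, the expected payoff of a control `z` is
`⟨w(t), x⟩ + 𝔼 ∫_t^T (z ⟨B, w⟩ - β z²) ds`, the Brownian terms being centred. The integrand is at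
most `H₀(w(s))`, with equality at the deterministic control `z*`. The HJB equation holds for
`⟨w(t), x⟩ + c(t)` because this function is affine in `x`.
-/

noncomputable section

namespace DelayControl

/-! ### Volterra convolutions -/

/-- Fubini's theorem on the triangle `a < y ≤ x ≤ b`. -/
lemma integral_triangle_swap {F : ℝ → ℝ → ℝ} {a b : ℝ} (hab : a ≤ b)
    (hF : IntegrableOn F.uncurry (Ioc a b ×ˢ Ioc a b)) :
    ∫ x in a..b, ∫ y in a..x, F x y = ∫ y in a..b, ∫ x in y..b, F x y := by
  have hm : MeasurableSet {p : ℝ × ℝ | p.2 ≤ p.1} := measurableSet_le measurable_snd measurable_fst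
  have key := intervalIntegral_intervalIntegral_swap (a := a) (b := b) (c := a) (d := b)
    (F := fun x y => ({p : ℝ × ℝ | p.2 ≤ p.1}.indicator F.uncurry) (x, y))
    (by rw [uIoc_of_le hab]; exact hF.indicator hm)
  convert key using 1
  · rw [intervalIntegral.integral_of_le hab, intervalIntegral.integral_of_le hab]
    refine setIntegral_congr_fun measurableSet_Ioc fun x hx => ?_
    rw [intervalIntegral.integral_of_le hx.1.le, intervalIntegral.integral_of_le hab]
    have : ∀ y, ({p : ℝ × ℝ | p.2 ≤ p.1}.indicator F.uncurry) (x, y)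
        = (Iic x).indicator (F x) y := fun y => by
      simp [indicator, Function.uncurry]
    simp_rw [this]
    rw [setIntegral_indicator measurableSet_Iic, Ioc_inter_Iic, min_eq_right hx.2]
  · rw [intervalIntegral.integral_of_le hab, intervalIntegral.integral_of_le hab]
    refine setIntegral_congr_fun measurableSet_Ioc fun y hy => ?_
    rw [intervalIntegral.integral_of_le hy.2, intervalIntegral.integral_of_le hab]
    have : ∀ x, ({p : ℝ × ℝ | p.2 ≤ p.1}.indicator F.uncurry) (x, y)
        = (Ici y).indicator (fun x => F x y) x := fun x => by
      simp [indicator, Function.uncurry]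
    simp_rw [this]
    rw [setIntegral_indicator measurableSet_Ici, ← integral_Icc_eq_integral_Ioc]
    congr 2
    ext x
    simp only [mem_Icc, mem_inter_iff, mem_Ioc, mem_Ici]
    exact ⟨fun h => ⟨⟨hy.1.trans_le h.1, h.2⟩, h.1⟩, fun h => ⟨h.2, h.1.2⟩⟩

/-- The Volterra convolution `s ↦ ∫_0^s f(s - τ) g(τ) dτ`. -/
def volterra (f g : ℝ → ℝ) (s : ℝ) : ℝ := ∫ τ in 0..s, f (s - τ) * g τ

lemma volterra_comm (f g : ℝ → ℝ) (s : ℝ) : volterra f g s = volterra g f s := by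
  have := intervalIntegral.integral_comp_sub_left (a := 0) (b := s)
    (fun τ => g (s - τ) * f τ) s
  simp only [sub_sub_cancel, sub_self, sub_zero] at this
  rw [volterra, volterra, ← this]
  simp_rw [mul_comm]

lemma continuous_volterra {f g : ℝ → ℝ} (hf : Continuous f) (hg : Continuous g) :
    Continuous (volterra f g) :=
  intervalIntegral.continuous_parametric_intervalIntegral_of_continuous
    (f := fun s τ => f (s - τ) * g τ) (by dsimp [Function.uncurry_def]; fun_prop) continuous_id

lemma intervalIntegrable_volterra {f ψ : ℝ → ℝ} (hf : Continuous f) {s : ℝ}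
    (hψ : IntervalIntegrable ψ volume 0 s) :
    IntervalIntegrable (fun τ => f (s - τ) * ψ τ) volume 0 s :=
  hψ.continuousOn_mul (by fun_prop)

lemma volterra_congr_left {f f' g : ℝ → ℝ} {s : ℝ} (hs : 0 ≤ s)
    (h : ∀ τ ∈ Icc 0 s, f τ = f' τ) : volterra f g s = volterra f' g s := by
  refine intervalIntegral.integral_congr fun τ hτ => ?_
  rw [uIcc_of_le hs] at hτ
  rw [h (s - τ) ⟨by linarith [hτ.2], by linarith [hτ.1]⟩]

lemma volterra_congr_right {f g g' : ℝ → ℝ} {s : ℝ} (hs : 0 ≤ s)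
    (h : ∀ τ ∈ Icc 0 s, g τ = g' τ) : volterra f g s = volterra f g' s := by
  rw [volterra_comm, volterra_congr_left hs h, volterra_comm]

lemma volterra_one (g : ℝ → ℝ) (s : ℝ) : volterra (fun _ => 1) g s = ∫ τ in 0..s, g τ := by
  simp [volterra]

lemma volterra_const (c : ℝ) (g : ℝ → ℝ) (s : ℝ) :
    volterra (fun _ => c) g s = c * ∫ τ in 0..s, g τ := by
  simp [volterra]

lemma volterra_add_left {f f' ψ : ℝ → ℝ} (hf : Continuous f) (hf' : Continuous f') {s : ℝ}
    (hψ : IntervalIntegrable ψ volume 0 s) :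
    volterra (fun τ => f τ + f' τ) ψ s = volterra f ψ s + volterra f' ψ s := by
  rw [volterra, volterra, volterra, ← intervalIntegral.integral_add
    (intervalIntegrable_volterra hf hψ) (intervalIntegrable_volterra hf' hψ)]
  simp_rw [add_mul]

lemma volterra_add_right {f ψ ψ' : ℝ → ℝ} (hf : Continuous f) {s : ℝ}
    (hψ : IntervalIntegrable ψ volume 0 s) (hψ' : IntervalIntegrable ψ' volume 0 s) :
    volterra f (fun τ => ψ τ + ψ' τ) s = volterra f ψ s + volterra f ψ' s := by
  rw [volterra, volterra, volterra, ← intervalIntegral.integral_add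
    (intervalIntegrable_volterra hf hψ) (intervalIntegrable_volterra hf hψ')]
  simp_rw [mul_add]

lemma volterra_smul_right (f : ℝ → ℝ) (c : ℝ) (ψ : ℝ → ℝ) (s : ℝ) :
    volterra f (fun τ => c * ψ τ) s = c * volterra f ψ s := by
  rw [volterra, volterra, ← intervalIntegral.integral_const_mul]
  congr 1; ext τ; ring

/-- Associativity of the Volterra convolution. It replaces every interchange of time integrals in
the variation of constants formulas; the last factor needs only to be integrable. -/
lemma volterra_assoc {f g ψ : ℝ → ℝ} (hf : Continuous f) (hg : Continuous g) {s : ℝ} (hs : 0 ≤ s)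
    (hψ : IntervalIntegrable ψ volume 0 s) :
    volterra f (volterra g ψ) s = volterra (volterra f g) ψ s := by
  have hψ' : IntegrableOn ψ (Ioc 0 s) := (intervalIntegrable_iff_integrableOn_Ioc_of_le hs).1 hψ
  obtain ⟨C, hC⟩ := ((isCompact_Icc (a := (0 : ℝ)) (b := s)).prod
    (isCompact_Icc (a := (0 : ℝ)) (b := s))).exists_bound_of_continuousOn
    (f := fun p : ℝ × ℝ => f (s - p.1) * g (p.1 - p.2)) (by fun_prop)
  have hint : IntegrableOn (fun p : ℝ × ℝ => f (s - p.1) * g (p.1 - p.2) * ψ p.2)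
      (Ioc 0 s ×ˢ Ioc 0 s) := by
    have h1 : IntegrableOn (fun p : ℝ × ℝ => (1 : ℝ) * ψ p.2) (Ioc 0 s ×ˢ Ioc 0 s) := by
      have := (integrable_const (μ := volume.restrict (Ioc 0 s)) (1 : ℝ)).mul_prod hψ'
      rwa [Measure.prod_restrict, ← Measure.volume_eq_prod] at this
    have h2 : Integrable (fun p : ℝ × ℝ => C * ((1 : ℝ) * ψ p.2))
      (volume.restrict (Ioc 0 s ×ˢ Ioc 0 s)) := h1.const_mul C
    refine h2.mono ?_ ?_
    · have hc : Continuous fun p : ℝ × ℝ => f (s - p.1) * g (p.1 - p.2) := by fun_prop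
      refine hc.aestronglyMeasurable.mul ?_
      simpa using h1.aestronglyMeasurable
    · refine (ae_restrict_iff' (measurableSet_Ioc.prod measurableSet_Ioc)).2 (ae_of_all _ ?_)
      rintro p ⟨hp1, hp2⟩
      have := hC p ⟨Ioc_subset_Icc_self hp1, Ioc_subset_Icc_self hp2⟩
      rw [norm_mul, one_mul, norm_mul (C)]
      gcongr
      exact this.trans (le_abs_self C)
  have h1 : ∀ x, f (s - x) * (∫ y in 0..x, g (x - y) * ψ y)
      = ∫ y in 0..x, f (s - x) * g (x - y) * ψ y := fun x => by
    rw [← intervalIntegral.integral_const_mul]; simp_rw [mul_assoc]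
  simp_rw [volterra, h1]
  rw [integral_triangle_swap (F := fun τ y => f (s - τ) * g (τ - y) * ψ y) hs hint]
  refine intervalIntegral.integral_congr fun y _ => ?_
  have h2 := intervalIntegral.integral_comp_sub_right (a := y) (b := s)
    (fun τ => f (s - y - τ) * g τ) y
  simp only [sub_self] at h2
  rw [← h2, ← intervalIntegral.integral_mul_const]
  congr 1; ext x; congr 3; ring

/-- The successive approximations `κ * ⋯ * κ * 1` of the Volterra equation `p = 1 + κ * p`. -/
def volterraIter (κ : ℝ → ℝ) : ℕ → ℝ → ℝ
  | 0 => fun _ => 1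
  | n + 1 => volterra κ (volterraIter κ n)

lemma continuous_volterraIter {κ : ℝ → ℝ} (hκ : Continuous κ) (n : ℕ) :
    Continuous (volterraIter κ n) := by
  induction n with
  | zero => exact continuous_const
  | succ n ih => exact continuous_volterra hκ ih

lemma abs_volterraIter_le {κ : ℝ → ℝ} {C T : ℝ}
    (hC : ∀ s ∈ Icc 0 T, |κ s| ≤ C) (n : ℕ) :
    ∀ s ∈ Icc 0 T, |volterraIter κ n s| ≤ C ^ n * s ^ n / n.factorial := by
  induction n with
  | zero => intro s _; simp [volterraIter]
  | succ n ih =>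
    intro s hs
    have hC0 : 0 ≤ C := (abs_nonneg _).trans (hC s hs)
    calc |volterraIter κ (n + 1) s|
        ≤ ∫ τ in 0..s, C * (C ^ n * τ ^ n / n.factorial) := by
          rw [volterraIter, volterra]
          refine intervalIntegral.norm_integral_le_of_norm_le (E := ℝ) hs.1 (ae_of_all _ fun τ hτ => ?_) ?_
          · rw [Real.norm_eq_abs, abs_mul]
            exact mul_le_mul (hC _ ⟨by linarith [hτ.2], by linarith [hτ.1, hs.2]⟩)
              (ih τ ⟨hτ.1.le, hτ.2.trans hs.2⟩) (abs_nonneg _) hC0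
          · exact Continuous.intervalIntegrable (by fun_prop) _ _
      _ = C ^ (n + 1) * s ^ (n + 1) / (n + 1).factorial := by
          have : ∀ τ : ℝ, C * (C ^ n * τ ^ n / n.factorial)
            = C ^ (n + 1) / n.factorial * τ ^ n := fun τ => by ring
          simp_rw [this]
          rw [intervalIntegral.integral_const_mul, integral_pow, Nat.factorial_succ]
          have := Nat.factorial_ne_zero n
          push_cast
          field_simp
          simp

/-- Solvability of the scalar linear Volterra equation `p = 1 + κ * p`. -/
theorem exists_volterra_solution {κ : ℝ → ℝ} (hκ : Continuous κ) {T : ℝ} (hT : 0 ≤ T) :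
    ∃ p : ℝ → ℝ, Continuous p ∧ ∀ s ∈ Icc 0 T, p s = 1 + volterra κ p s := by
  obtain ⟨C, hC⟩ := (isCompact_Icc (a := (0 : ℝ)) (b := T)).exists_bound_of_continuousOn
    hκ.continuousOn
  have hC0 : 0 ≤ C := (norm_nonneg _).trans (hC 0 (left_mem_Icc.2 hT))
  have hb := abs_volterraIter_le hC
  set u : ℕ → ℝ := fun n => (C * T) ^ n / n.factorial
  have hu : Summable u := Real.summable_pow_div_factorial (C * T)
  have hbu : ∀ n, ∀ s ∈ Icc 0 T, ‖volterraIter κ n s‖ ≤ u n := fun n s hs => by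
    refine (hb n s hs).trans ?_
    simp only [u, mul_pow]
    gcongr
    exacts [hs.1, hs.2]
  let π : ℝ → ℝ := fun s => projIcc 0 T hT s
  have hπ : Continuous π := continuous_subtype_val.comp continuous_projIcc
  have hπm : ∀ s, π s ∈ Icc 0 T := fun s => (projIcc 0 T hT s).2
  have hπe : ∀ s ∈ Icc 0 T, π s = s := fun s hs => by simp [π, projIcc_of_mem hT hs]
  refine ⟨fun s => ∑' n, volterraIter κ n (π s), ?_, fun s hs => ?_⟩
  · exact continuous_tsum (fun n => (continuous_volterraIter hκ n).comp hπ) hu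
      fun n s => hbu n _ (hπm s)
  · have hsum : ∀ τ ∈ Icc 0 T, HasSum (fun n => volterraIter κ n τ)
        (∑' n, volterraIter κ n (π τ)) := fun τ hτ => by
      rw [hπe τ hτ]
      exact (Summable.of_norm_bounded hu fun n => hbu n τ hτ).hasSum
    have h1 : HasSum (fun n => volterraIter κ (n + 1) s)
        (volterra κ (fun τ => ∑' n, volterraIter κ n (π τ)) s) := by
      refine intervalIntegral.hasSum_integral_of_dominated_convergence (fun n _ => C * u n)
        (fun n => ?_) (fun n => ae_of_all _ fun τ hτ => ?_) (ae_of_all _ fun τ _ => hu.mul_left C)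
        intervalIntegrable_const (ae_of_all _ fun τ hτ => ?_)
      · have := continuous_volterraIter hκ n
        exact Continuous.aestronglyMeasurable (by fun_prop)
      · rw [uIoc_of_le hs.1] at hτ
        rw [norm_mul]
        exact mul_le_mul (hC _ ⟨by linarith [hτ.2], by linarith [hτ.1, hs.2]⟩)
          (hbu n τ ⟨hτ.1.le, hτ.2.trans hs.2⟩) (norm_nonneg _) hC0
      · rw [uIoc_of_le hs.1] at hτ
        exact (hsum τ ⟨hτ.1.le, hτ.2.trans hs.2⟩).mul_left _
    have h2 := (hasSum_nat_add_iff' 1).2 (hsum s hs)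
    have := h2.unique h1
    simp only [Finset.range_one, Finset.sum_singleton, volterraIter] at this
    dsimp only
    linarith

/-! ### Sobolev functions and the graphs of the delay operators -/

lemma L2.inner_eq {r : ℝ} (f g : L2 r) : ⟪f, g⟫_ℝ = ∫ ξ in Icc (-r) 0, f ξ * g ξ := by
  rw [MeasureTheory.L2.inner_def]
  simp [mul_comm]

lemma L2.inner_eq_intervalIntegral {r : ℝ} (hr : 0 ≤ r) (f g : L2 r) :
    ⟪f, g⟫_ℝ = ∫ ξ in (-r)..0, f ξ * g ξ := by
  rw [L2.inner_eq, intervalIntegral.integral_of_le (by linarith), integral_Icc_eq_integral_Ioc]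

lemma X.inner_eq {r : ℝ} (x y : X r) :
    ⟪x, y⟫_ℝ = x.fst * y.fst + ⟪x.snd, y.snd⟫_ℝ := by
  rw [WithLp.prod_inner_apply]
  congr 1
  exact mul_comm _ _

/-- Integration by parts in `W^{1,2}([-r,0])`. -/
lemma IsW12.inner_add_inner {r : ℝ} (hr : 0 ≤ r) {f f' g g' : L2 r} {F G : ℝ → ℝ}
    (hf : IsW12 f f' F) (hg : IsW12 g g' G) :
    ⟪f', g⟫_ℝ + ⟪f, g'⟫_ℝ = F 0 * G 0 - F (-r) * G (-r) := by
  have hr0 : -r ≤ 0 := by linarith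
  have hac : ∀ (u : L2 r) (c : ℝ),
      AbsolutelyContinuousOnInterval (fun ξ => c + ∫ v in (-r)..ξ, u v) (-r) 0 := fun u c => by
    refine AbsolutelyContinuousOnInterval.add ?_ ?_
    · exact (LipschitzWith.const c : LipschitzWith 0 _).lipschitzOnWith.absolutelyContinuousOnInterval
    · exact (u.intervalIntegrable ⟨hr0, le_rfl⟩).absolutelyContinuousOnInterval_intervalIntegral
        left_mem_uIcc
  have hder : ∀ (u : L2 r) (c : ℝ), ∀ᵐ ξ, ξ ∈ uIcc (-r) 0 →
      deriv (fun ξ => c + ∫ v in (-r)..ξ, u v) ξ = u ξ := fun u c => by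
    filter_upwards [(u.intervalIntegrable ⟨hr0, le_rfl⟩).ae_hasDerivAt_integral] with ξ h hξ
    exact ((h hξ (-r) left_mem_uIcc).const_add c).deriv
  have key := (hac f' (F (-r))).integral_deriv_mul_eq_sub (hac g' (G (-r)))
  rw [← hf.2 0 ⟨hr0, le_rfl⟩, ← hg.2 0 ⟨hr0, le_rfl⟩] at key
  simp only [intervalIntegral.integral_same, add_zero] at key
  rw [← key, L2.inner_eq, L2.inner_eq, ← integral_add, intervalIntegral.integral_of_le hr0,
    integral_Icc_eq_integral_Ioc]
  · have hsub : ∀ {q : ℝ → Prop}, (∀ᵐ ξ ∂(volume.restrict (Icc (-r) 0)), q ξ) →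
        ∀ᵐ ξ ∂(volume.restrict (Ioc (-r) 0)), q ξ :=
      fun hq => ae_restrict_of_ae_restrict_of_subset Ioc_subset_Icc_self hq
    refine integral_congr_ae ?_
    filter_upwards [hsub hf.1, hsub hg.1, ae_restrict_of_ae (hder f' (F (-r))),
      ae_restrict_of_ae (hder g' (G (-r))), ae_restrict_mem measurableSet_Ioc] with ξ h1 h2 h3 h4 hξ
    have hξ' := Ioc_subset_Icc_self hξ
    rw [uIcc_of_le hr0] at h3 h4
    rw [h3 hξ', h4 hξ', h1, h2, ← hf.2 ξ hξ', ← hg.2 ξ hξ']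
  · exact (Lp.memLp f').integrable_mul (Lp.memLp g)
  · exact (Lp.memLp f).integrable_mul (Lp.memLp g')

/-- The element of `W^{1,2}([-r,0])` with derivative `g` and value `c` at `-r`. -/
lemma exists_isW12 {r : ℝ} (hr : 0 ≤ r) (c : ℝ) (g : L2 r) :
    ∃ f : L2 r, IsW12 f g (fun ξ => c + ∫ v in (-r)..ξ, g v) := by
  have hr0 : -r ≤ 0 := by linarith
  have hc : ContinuousOn (fun ξ => c + ∫ v in (-r)..ξ, g v) (Icc (-r) 0) := by
    refine continuousOn_const.add ?_
    have := intervalIntegral.continuousOn_primitive_interval (f := g) (μ := volume)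
      (a := -r) (b := 0) (by rw [uIcc_of_le hr0]; exact (Lp.memLp g).integrable (by norm_num))
    rwa [uIcc_of_le hr0] at this
  obtain ⟨C, hC⟩ := isCompact_Icc.exists_bound_of_continuousOn hc
  have hm : MemLp (fun ξ => c + ∫ v in (-r)..ξ, g v) 2 (volume.restrict (Icc (-r) 0)) :=
    (memLp_top_of_bound (hc.aestronglyMeasurable measurableSet_Icc) _
      ((ae_restrict_iff' measurableSet_Icc).2 (ae_of_all _ hC))).mono_exponent le_top
  exact ⟨hm.toLp _, hm.coeFn_toLp, fun ξ _ => by simp⟩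

/-- A closedness property of the pair `(A, A*)`: the adjoint of `A*` is contained in `A`. -/
lemma mem_graphA_of_inner_eq {r : ℝ} (hr : 0 ≤ r) {a₀ : ℝ} {a₁ : L2 r} {m d : X r}
    (h : ∀ p ∈ graphAstar r a₀ a₁, ⟪d, p.1⟫_ℝ = ⟪m, p.2⟫_ℝ) : (m, d) ∈ graphA r a₀ a₁ := by
  have hr0 : -r ≤ 0 := by linarith
  set k : L2 r := m.fst • a₁ - d.snd with hk
  obtain ⟨κ, hκ⟩ := exists_isW12 hr 0 k
  set K : ℝ → ℝ := fun ξ => 0 + ∫ v in (-r)..ξ, k v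
  have hK : K (-r) = 0 := by simp [K]
  -- testing against `ζ = (F(0), F)` with arbitrary `F(-r) = c` and `F' = g`
  have key : ∀ (c : ℝ) (g : L2 r), (d.fst - a₀ * m.fst - K 0) * (c + ∫ v in (-r)..0, g v)
      = ⟪m.snd - κ, g⟫_ℝ := fun c g => by
    obtain ⟨f, hf⟩ := exists_isW12 hr c g
    have h1 := h (WithLp.toLp 2 (c + ∫ v in (-r)..0, g v, f),
      WithLp.toLp 2 (a₀ * (c + ∫ v in (-r)..0, g v) + ⟪a₁, f⟫_ℝ, g)) ⟨_, hf, rfl, rfl⟩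
    have h2 := hκ.inner_add_inner hr hf
    rw [hK, hk, inner_sub_left, inner_smul_left] at h2
    rw [X.inner_eq, X.inner_eq] at h1
    rw [inner_sub_left]
    simp only [conj_trivial, WithLp.toLp_fst, WithLp.toLp_snd] at h1 h2
    linear_combination h1 + h2
  have h1 := key 1 0
  have h2 : ∫ v in (-r)..0, (0 : L2 r) v = 0 := by
    have := (IsW12.zero r).2 0 ⟨hr0, le_rfl⟩
    simpa using this.symm
  rw [h2, inner_zero_right] at h1
  have h3 : d.fst - a₀ * m.fst - K 0 = 0 := by linarith
  have h4 := key 0 (m.snd - κ)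
  rw [h3, zero_mul] at h4
  have h5 : m.snd = κ := sub_eq_zero.1 (inner_self_eq_zero.1 h4.symm)
  exact ⟨K, k, h5 ▸ hκ, hK, by change d.fst = a₀ * m.fst + K 0; linarith,
    by change d.snd = m.fst • a₁ - k; rw [hk]; abel⟩

/-- A closedness property of the pair `(A, A*)`: the adjoint of `A` is contained in `A*`. -/
lemma mem_graphAstar_of_inner_eq {r : ℝ} (hr : 0 ≤ r) {a₀ : ℝ} {a₁ : L2 r} {m d : X r}
    (h : ∀ p ∈ graphA r a₀ a₁, ⟪d, p.1⟫_ℝ = ⟪m, p.2⟫_ℝ) : (m, d) ∈ graphAstar r a₀ a₁ := by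
  have hr0 : -r ≤ 0 := by linarith
  -- the test vector `(1, 0)` determines the head of `d`
  have h0 := h (WithLp.toLp 2 (1, 0), WithLp.toLp 2 (a₀ * 1 + 0, (1 : ℝ) • a₁ - 0))
    ⟨_, 0, IsW12.zero r, rfl, rfl, rfl⟩
  rw [X.inner_eq, X.inner_eq] at h0
  simp only [WithLp.toLp_fst, WithLp.toLp_snd, inner_zero_right, one_smul, sub_zero] at h0
  obtain ⟨δ, hδ⟩ := exists_isW12 hr (m.fst - ∫ v in (-r)..0, d.snd v) d.snd
  have h1 : ∀ g : L2 r, ⟪m.snd - δ, g⟫_ℝ = 0 := fun g => by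
    obtain ⟨f, hf⟩ := exists_isW12 hr 0 g
    have h2 := h (WithLp.toLp 2 (0, f),
      WithLp.toLp 2 (a₀ * 0 + (0 + ∫ v in (-r)..0, g v), (0 : ℝ) • a₁ - g))
      ⟨_, g, hf, by simp, rfl, rfl⟩
    have h3 := hδ.inner_add_inner hr hf
    rw [X.inner_eq, X.inner_eq] at h2
    rw [inner_sub_left]
    simp only [WithLp.toLp_fst, WithLp.toLp_snd, zero_smul, zero_sub, inner_neg_right,
      intervalIntegral.integral_same] at h2 h3
    linear_combination h2 - h3
  have h5 : m.snd = δ := sub_eq_zero.1 (inner_self_eq_zero.1 (h1 _))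
  refine ⟨_, h5 ▸ hδ, ?_, ?_⟩
  · change m.fst = (m.fst - ∫ v in (-r)..0, d.snd v) + ∫ v in (-r)..0, d.snd v
    ring
  · change d.fst = a₀ * m.fst + ⟪a₁, m.snd⟫_ℝ
    rw [real_inner_comm]
    linarith

/-- The bound for the terms common to `⟨A m, m⟩` and `⟨A* m, m⟩`. -/
lemma quasiDissipative_bound {r : ℝ} (a₀ : ℝ) (a₁ : L2 r) (m : X r) :
    a₀ * m.fst ^ 2 + m.fst ^ 2 / 2 + m.fst * ⟪a₁, m.snd⟫_ℝ
      ≤ (|a₀| + 1 / 2 + ‖a₁‖) * ‖m‖ ^ 2 := by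
  have h1 : ‖m‖ ^ 2 = m.fst ^ 2 + ‖m.snd‖ ^ 2 := by
    rw [WithLp.prod_norm_sq_eq_of_L2, Real.norm_eq_abs, sq_abs]
  have h2 : m.fst * ⟪a₁, m.snd⟫_ℝ ≤ |m.fst| * (‖a₁‖ * ‖m.snd‖) := by
    refine (le_abs_self _).trans ?_
    rw [abs_mul]
    exact mul_le_mul_of_nonneg_left (abs_real_inner_le_norm _ _) (abs_nonneg _)
  have h3 : |m.fst| * ‖m.snd‖ ≤ ‖m‖ ^ 2 := by
    nlinarith [sq_nonneg (|m.fst| - ‖m.snd‖), sq_abs m.fst, sq_nonneg m.fst, sq_nonneg ‖m.snd‖]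
  have h4 : m.fst ^ 2 ≤ ‖m‖ ^ 2 := by nlinarith [sq_nonneg ‖m.snd‖]
  have h5 : ‖a₁‖ * (|m.fst| * ‖m.snd‖) ≤ ‖a₁‖ * ‖m‖ ^ 2 :=
    mul_le_mul_of_nonneg_left h3 (norm_nonneg _)
  have h6 : a₀ * m.fst ^ 2 ≤ |a₀| * ‖m‖ ^ 2 :=
    mul_le_mul (le_abs_self _) h4 (sq_nonneg _) (abs_nonneg _)
  linarith

/-- `A` is quasi-dissipative; the boundary term `x₁(0) x₀ - x₁(0)² / 2` is at most `x₀² / 2`. -/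
lemma inner_le_of_mem_graphA {r : ℝ} (hr : 0 ≤ r) {a₀ : ℝ} {a₁ : L2 r} {m d : X r}
    (h : (m, d) ∈ graphA r a₀ a₁) : ⟪d, m⟫_ℝ ≤ (|a₀| + 1 / 2 + ‖a₁‖) * ‖m‖ ^ 2 := by
  obtain ⟨F, g, h1, h2, h3, h4⟩ := h
  change d.fst = a₀ * m.fst + F 0 at h3
  change d.snd = m.fst • a₁ - g at h4
  have h5 := h1.inner_add_inner hr h1
  change ⟪g, m.snd⟫_ℝ + ⟪m.snd, g⟫_ℝ = _ at h5
  rw [h2, real_inner_comm] at h5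
  refine le_trans ?_ (quasiDissipative_bound a₀ a₁ m)
  -- the boundary terms combine to `m₀²/2 - (m₀ - F(0))²/2`
  rw [X.inner_eq, h3, h4, inner_sub_left, inner_smul_left, conj_trivial, real_inner_comm m.snd g]
  nlinarith [sq_nonneg (m.fst - F 0)]

/-- `A*` is quasi-dissipative. -/
lemma inner_le_of_mem_graphAstar {r : ℝ} (hr : 0 ≤ r) {a₀ : ℝ} {a₁ : L2 r} {m d : X r}
    (h : (m, d) ∈ graphAstar r a₀ a₁) : ⟪d, m⟫_ℝ ≤ (|a₀| + 1 / 2 + ‖a₁‖) * ‖m‖ ^ 2 := by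
  obtain ⟨F, h1, h2, h3⟩ := h
  change m.fst = F 0 at h2
  change d.fst = a₀ * m.fst + ⟪a₁, m.snd⟫_ℝ at h3
  have h5 := h1.inner_add_inner hr h1
  change ⟪d.snd, m.snd⟫_ℝ + ⟪m.snd, d.snd⟫_ℝ = _ at h5
  rw [← h2, real_inner_comm] at h5
  refine le_trans ?_ (quasiDissipative_bound a₀ a₁ m)
  rw [X.inner_eq, h3, real_inner_comm m.snd d.snd]
  nlinarith [sq_nonneg (F (-r))]

/-- `D(A*)` is dense. -/
lemma eq_zero_of_inner_graphAstar {r : ℝ} (hr : 0 < r) {a₀ : ℝ} {a₁ : L2 r} {d : X r}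
    (h : ∀ p ∈ graphAstar r a₀ a₁, ⟪d, p.1⟫_ℝ = 0) : d = 0 := by
  have h1 : ((0 : X r), d) ∈ graphA r a₀ a₁ :=
    mem_graphA_of_inner_eq hr.le fun p hp => by rw [h p hp, inner_zero_left]
  rw [← opA_graph hr] at h1
  exact LinearPMap.graph_fst_eq_zero_snd _ h1 rfl

/-- `D(A)` is dense. -/
lemma eq_zero_of_inner_graphA {r : ℝ} (hr : 0 < r) {a₀ : ℝ} {a₁ : L2 r} {d : X r}
    (h : ∀ p ∈ graphA r a₀ a₁, ⟪d, p.1⟫_ℝ = 0) : d = 0 := by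
  have h1 : ((0 : X r), d) ∈ graphAstar r a₀ a₁ :=
    mem_graphAstar_of_inner_eq hr.le fun p hp => by rw [h p hp, inner_zero_left]
  rw [← opAstar_graph hr] at h1
  exact LinearPMap.graph_fst_eq_zero_snd _ h1 rfl

/-! ### Translations in `L²` -/

/-- The translate `ξ ↦ φ(ξ - s)` of a square integrable function on the line, restricted to
`[-r,0]`. -/
def translate (r : ℝ) {φ : ℝ → ℝ} (hφ : MemLp φ 2 (volume : Measure ℝ)) (s : ℝ) : L2 r :=
  LpToLpRestrictCLM ℝ ℝ ℝ volume 2 (Icc (-r) 0) (DomAddAct.mk (-s) +ᵥ hφ.toLp φ)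

lemma translate_ae {r : ℝ} {φ : ℝ → ℝ} (hφ : MemLp φ 2 (volume : Measure ℝ)) (s : ℝ) :
    ∀ᵐ ξ ∂(volume.restrict (Icc (-r) 0)), translate r hφ s ξ = φ (ξ - s) := by
  have h1 := LpToLpRestrictCLM_coeFn (F := ℝ) ℝ (μ := volume) (p := 2) (Icc (-r) 0)
    (DomAddAct.mk (-s) +ᵥ hφ.toLp φ)
  rw [DomAddAct.mk_vadd_toLp] at h1
  have h2 := ae_restrict_of_ae (s := Icc (-r) 0) (MemLp.coeFn_toLp (hφ.comp_measurePreserving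
    (measurePreserving_vadd (-s) (volume : Measure ℝ))))
  rw [translate, DomAddAct.mk_vadd_toLp]
  filter_upwards [h1, h2] with ξ h3 h4
  rw [h3]
  refine h4.trans ?_
  simp [sub_eq_neg_add]

lemma continuous_translate (r : ℝ) {φ : ℝ → ℝ} (hφ : MemLp φ 2 (volume : Measure ℝ)) :
    Continuous (translate r hφ) := by
  refine (LpToLpRestrictCLM ℝ ℝ ℝ volume 2 (Icc (-r) 0)).continuous.comp ?_
  have : Continuous fun s : ℝ => DomAddAct.mk (-s) :=
    DomAddAct.continuous_mk.comp continuous_neg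
  have h2 : Fact ((2 : ℝ≥0∞) ≠ ∞) := ⟨by norm_num⟩
  exact this.vadd continuous_const

/-- The extension by zero of an element of `L²([-r,0])`. -/
def extend {r : ℝ} (f : L2 r) : ℝ → ℝ := (Icc (-r) 0).indicator f

lemma memLp_extend {r : ℝ} (f : L2 r) : MemLp (extend f) 2 (volume : Measure ℝ) :=
  (memLp_indicator_iff_restrict measurableSet_Icc).2 (Lp.memLp f)

lemma integrable_extend {r : ℝ} (f : L2 r) : Integrable (extend f) :=
  (integrable_indicator_iff measurableSet_Icc).2 ((Lp.memLp f).integrable (by norm_num))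

/-! ### Weak linear evolution equations in a Hilbert space -/

lemma intervalIntegrable_duhamel {E : Type*} [NormedAddCommGroup E] [NormedSpace ℝ E] {ψ : ℝ → ℝ} {v : ℝ → E} (hv : Continuous v) {s : ℝ}
    (hψ : IntervalIntegrable ψ volume 0 s) :
    IntervalIntegrable (fun τ => ψ τ • v (s - τ)) volume 0 s :=
  hψ.smul_continuousOn (by fun_prop)

section Abstract

variable {E : Type*} [NormedAddCommGroup E] [InnerProductSpace ℝ E] [CompleteSpace E]

lemma integral_inner_left {D : ℝ → E} {a b : ℝ} (hD : IntervalIntegrable D volume a b) (η : E) :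
    ∫ τ in a..b, ⟪D τ, η⟫_ℝ = ⟪∫ τ in a..b, D τ, η⟫_ℝ := by
  have := (innerSL ℝ η).intervalIntegral_comp_comm hD
  simp only [innerSL_apply_apply] at this
  rw [real_inner_comm, ← this]
  simp_rw [real_inner_comm]

/-- Uniqueness for the weak equation `D' = A D`, `D(a) = 0`. Its test set `Γ` is the graph of the
adjoint of `A`. The time integral of `D` lies in the domain of the adjoint of `Γ`, so that it is
a strict solution, and quasi-dissipativity makes `exp(-2Cs) ‖∫_a^s D‖²` nonincreasing. -/
theorem eq_zero_of_weak_homogeneous {Γ : Set (E × E)} {C a b : ℝ} (hab : a ≤ b) {D : ℝ → E}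
    (hD : ContinuousOn D (Icc a b))
    (heq : ∀ p ∈ Γ, ∀ s ∈ Icc a b, ⟪D s, p.1⟫_ℝ = ∫ τ in a..s, ⟪D τ, p.2⟫_ℝ)
    (hdiss : ∀ m d : E, (∀ p ∈ Γ, ⟪d, p.1⟫_ℝ = ⟪m, p.2⟫_ℝ) → ⟪d, m⟫_ℝ ≤ C * ‖m‖ ^ 2)
    (hsep : ∀ d : E, (∀ p ∈ Γ, ⟪d, p.1⟫_ℝ = 0) → d = 0) :
    ∀ s ∈ Icc a b, D s = 0 := by
  set D' : ℝ → E := fun s => D (projIcc a b hab s) with hD'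
  have hD'c : Continuous D' :=
    hD.comp_continuous (continuous_subtype_val.comp continuous_projIcc) fun s => Subtype.prop _
  have hDD' : ∀ s ∈ Icc a b, D' s = D s := fun s hs => by simp [D', projIcc_of_mem hab hs]
  set M : ℝ → E := fun s => ∫ τ in a..s, D' τ
  have hM : ∀ s, HasDerivAt M (D' s) s := fun s => (hD'c.integral_hasStrictDerivAt a s).hasDerivAt
  have hDM : ∀ s ∈ Icc a b, ∀ p ∈ Γ, ⟪D s, p.1⟫_ℝ = ⟪M s, p.2⟫_ℝ := fun s hs p hp => by
    rw [heq p hp s hs, ← integral_inner_left (hD'c.intervalIntegrable a s)]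
    refine intervalIntegral.integral_congr fun τ hτ => ?_
    rw [uIcc_of_le hs.1] at hτ
    rw [hDD' τ ⟨hτ.1, hτ.2.trans hs.2⟩]
  set f : ℝ → ℝ := fun s => Real.exp (-(2 * C) * s) * ⟪M s, M s⟫_ℝ
  have hf : ∀ s, HasDerivAt f (Real.exp (-(2 * C) * s) * (2 * (⟪D' s, M s⟫_ℝ - C * ‖M s‖ ^ 2))) s :=
    fun s => by
    have h1 : HasDerivAt (fun s => Real.exp (-(2 * C) * s))
        (Real.exp (-(2 * C) * s) * (-(2 * C) * 1)) s :=
      ((hasDerivAt_id s).const_mul (-(2 * C))).exp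
    refine (h1.mul ((hM s).inner ℝ (hM s))).congr_deriv ?_
    rw [real_inner_comm (D' s) (M s), real_inner_self_eq_norm_sq]
    ring
  have hanti : AntitoneOn f (Icc a b) := by
    refine antitoneOn_of_deriv_nonpos (convex_Icc a b)
      (fun s _ => (hf s).continuousAt.continuousWithinAt)
      (fun s _ => (hf s).differentiableAt.differentiableWithinAt) fun s hs => ?_
    have hs' : s ∈ Icc a b := interior_subset hs
    rw [(hf s).deriv]
    have := hdiss (M s) (D s) (hDM s hs')
    rw [hDD' s hs']
    exact mul_nonpos_of_nonneg_of_nonpos (Real.exp_pos _).le (by linarith)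
  intro s hs
  have h1 := hanti (left_mem_Icc.2 hab) hs hs.1
  have h2 : f a = 0 := by simp [f, M]
  have h3 : M s = 0 := by
    rw [h2] at h1
    have h4 : ⟪M s, M s⟫_ℝ ≤ 0 := nonpos_of_mul_nonpos_right h1 (Real.exp_pos _)
    rw [real_inner_self_eq_norm_sq] at h4
    exact norm_eq_zero.1 (pow_eq_zero_iff two_ne_zero |>.1 (le_antisymm h4 (sq_nonneg _)))
  exact hsep _ fun p hp => by rw [hDM s hs p hp, h3, inner_zero_left]

/-- The convolution `s ↦ ∫_0^s ψ(τ) v(s - τ) dτ` of a scalar forcing with a vector valued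
evolution. -/
def duhamel (ψ : ℝ → ℝ) (v : ℝ → E) (s : ℝ) : E := ∫ τ in 0..s, ψ τ • v (s - τ)

lemma inner_duhamel {ψ : ℝ → ℝ} {v : ℝ → E} (hv : Continuous v) {s : ℝ}
    (hψ : IntervalIntegrable ψ volume 0 s) (ζ : E) :
    ⟪duhamel ψ v s, ζ⟫_ℝ = volterra (fun τ => ⟪v τ, ζ⟫_ℝ) ψ s := by
  rw [duhamel, ← integral_inner_left (intervalIntegrable_duhamel hv hψ)]
  simp_rw [volterra, inner_smul_left, conj_trivial, mul_comm]

lemma intervalIntegrable_of_mem_Icc {ψ : ℝ → ℝ} {T s : ℝ} (hψ : IntervalIntegrable ψ volume 0 T)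
    (hs : s ∈ Icc 0 T) : IntervalIntegrable ψ volume 0 s :=
  hψ.mono_set (by
    rw [uIcc_of_le hs.1, uIcc_of_le (hs.1.trans hs.2)]; exact Icc_subset_Icc_right hs.2)

lemma continuousOn_duhamel {ψ : ℝ → ℝ} {v : ℝ → E} (hv : Continuous v) {T : ℝ} (hT : 0 ≤ T)
    (hψ : IntervalIntegrable ψ volume 0 T) : ContinuousOn (duhamel ψ v) (Icc 0 T) := by
  -- subtracting `v(0)` removes the jump of the integrand at the upper end `τ = s`
  let v' : ℝ → E := fun u => v (projIcc 0 T hT u) - v 0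
  have hv' : Continuous v' :=
    (hv.comp (continuous_subtype_val.comp continuous_projIcc)).sub continuous_const
  obtain ⟨C, hC⟩ := (isCompact_Icc (a := (0 : ℝ)) (b := T)).exists_bound_of_continuousOn
    (f := fun u => v u - v 0) (by fun_prop)
  have h1 : ContinuousOn (fun s => (∫ τ in 0..s, ψ τ) • v 0) (Icc 0 T) := by
    refine ContinuousOn.smul ?_ continuousOn_const
    have := intervalIntegral.continuousOn_primitive_interval' (f := ψ) (μ := volume)
      (a := 0) (b₁ := 0) (b₂ := T) hψ left_mem_uIcc
    rwa [uIcc_of_le hT] at this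
  have h2 : Continuous fun s => ∫ τ in 0..T, ψ τ • v' (s - τ) := by
    refine intervalIntegral.continuous_of_dominated_interval (bound := fun τ => |ψ τ| * C)
      (fun s => ?_) (fun s => ae_of_all _ fun τ _ => ?_) (hψ.abs.mul_const C)
      (ae_of_all _ fun τ _ => by fun_prop)
    · have h3 : Continuous fun τ => v' (s - τ) := by fun_prop
      exact (intervalIntegrable_iff.1 hψ).aestronglyMeasurable.smul h3.aestronglyMeasurable
    · rw [norm_smul]
      exact mul_le_mul_of_nonneg_left (hC _ (Subtype.prop _)) (norm_nonneg _)
  refine (h1.add h2.continuousOn).congr fun s hs => ?_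
  have hs1 := intervalIntegrable_of_mem_Icc hψ hs
  have h4 : ∫ τ in 0..T, ψ τ • v' (s - τ) = ∫ τ in 0..s, ψ τ • v' (s - τ) := by
    have hi : ∀ a ∈ Icc 0 T, ∀ b ∈ Icc 0 T,
        IntervalIntegrable (fun τ => ψ τ • v' (s - τ)) volume a b := fun a ha b hb =>
      ((intervalIntegrable_of_mem_Icc hψ ha).symm.trans
        (intervalIntegrable_of_mem_Icc hψ hb)).smul_continuousOn (by fun_prop)
    rw [← intervalIntegral.integral_add_adjacent_intervals (hi 0 (left_mem_Icc.2 hT) s hs)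
      (hi s hs T (right_mem_Icc.2 hT))]
    rw [intervalIntegral.integral_zero_ae (a := s), add_zero]
    refine ae_of_all _ fun τ hτ => ?_
    rw [uIoc_of_le hs.2] at hτ
    simp [v', projIcc_of_le_left hT (by linarith [hτ.1] : s - τ ≤ 0)]
  rw [Pi.add_apply, h4, ← intervalIntegral.integral_smul_const, ← intervalIntegral.integral_add]
  · refine intervalIntegral.integral_congr fun τ hτ => ?_
    rw [uIcc_of_le hs.1] at hτ
    have : s - τ ∈ Icc 0 T := ⟨by linarith [hτ.2], by linarith [hτ.1, hs.2]⟩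
    simp [v', projIcc_of_mem hT this, smul_sub]
  · exact hs1.smul_continuousOn (f := ψ) (g := fun _ => v 0) continuousOn_const
  · exact hs1.smul_continuousOn (f := ψ) (g := fun τ => v' (s - τ)) (by fun_prop)

/-- Duhamel's principle: if `v` is tested by `⟨v, ζ⟩' = ⟨v, η⟩`, then its convolution with `ψ`
satisfies the same equation with the forcing `ψ v(0)`. -/
lemma inner_duhamel_eq {ψ : ℝ → ℝ} {v : ℝ → E} (hv : Continuous v) {T : ℝ}
    (hψ : IntervalIntegrable ψ volume 0 T) {ζ η : E}
    (h : ∀ s ∈ Icc 0 T, ⟪v s, ζ⟫_ℝ = ⟪v 0, ζ⟫_ℝ + ∫ τ in 0..s, ⟪v τ, η⟫_ℝ) :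
    ∀ s ∈ Icc 0 T, ⟪duhamel ψ v s, ζ⟫_ℝ
      = ⟪v 0, ζ⟫_ℝ * (∫ τ in 0..s, ψ τ) + ∫ τ in 0..s, ⟪duhamel ψ v τ, η⟫_ℝ := by
  intro s hs
  have hm : Continuous fun τ => ⟪v τ, η⟫_ℝ := hv.inner continuous_const
  have hψs := intervalIntegrable_of_mem_Icc hψ hs
  rw [inner_duhamel hv hψs, volterra_congr_left hs.1 (f' := fun τ => ⟪v 0, ζ⟫_ℝ +
      volterra (fun _ => 1) (fun τ => ⟪v τ, η⟫_ℝ) τ) fun τ hτ => by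
        rw [h τ ⟨hτ.1, hτ.2.trans hs.2⟩, volterra_one],
    volterra_add_left continuous_const (continuous_volterra continuous_const hm) hψs,
    volterra_const, ← volterra_assoc continuous_const hm hs.1 hψs, volterra_one]
  congr 1
  refine intervalIntegral.integral_congr fun τ hτ => ?_
  rw [uIcc_of_le hs.1] at hτ
  exact (inner_duhamel hv (intervalIntegrable_of_mem_Icc hψs hτ) η).symm

end Abstract

/-! ### The unperturbed evolution: translation with absorption at the head -/

/-- The function `u ↦ f(-u)` of the elapsed time, extended by zero. -/
def reflect {r : ℝ} (f : L2 r) (u : ℝ) : ℝ := extend f (-u)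

lemma integrable_reflect {r : ℝ} (f : L2 r) : Integrable (reflect f) :=
  (integrable_extend f).comp_neg

lemma intervalIntegrable_reflect {r : ℝ} (f : L2 r) (a b : ℝ) :
    IntervalIntegrable (reflect f) volume a b :=
  (integrable_reflect f).intervalIntegrable

lemma continuous_integral_reflect {r : ℝ} (f : L2 r) :
    Continuous fun s => ∫ u in 0..s, reflect f u :=
  intervalIntegral.continuous_primitive (intervalIntegrable_reflect f) 0

lemma integral_reflect {r : ℝ} (f : L2 r) (s : ℝ) :
    ∫ u in 0..s, reflect f u = ∫ u in (-s)..0, extend f u := by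
  simp [reflect]

lemma inner_translate {r : ℝ} {φ : ℝ → ℝ} (hφ : MemLp φ 2 (volume : Measure ℝ)) (s : ℝ)
    (f : L2 r) : ⟪translate r hφ s, f⟫_ℝ = ∫ ξ, φ (ξ - s) * extend f ξ := by
  rw [L2.inner_eq, extend]
  have : ∀ ξ, φ (ξ - s) * (Icc (-r) 0).indicator f ξ
      = (Icc (-r) 0).indicator (fun ξ => φ (ξ - s) * f ξ) ξ := fun ξ => by
    by_cases h : ξ ∈ Icc (-r) 0 <;> simp [h]
  simp_rw [this]
  rw [integral_indicator measurableSet_Icc]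
  refine integral_congr_ae ?_
  filter_upwards [translate_ae hφ s] with ξ h
  rw [h]

/-- The solution of `dx/ds = (x₁(0), -x₁')` with inflow condition `x₁(-r) = 0`: the history
component is translated, and the mass that it loses at `0` is added to the head. -/
def shiftFlow {r : ℝ} (x : X r) (s : ℝ) : X r :=
  WithLp.toLp 2 (x.fst + ∫ u in 0..s, reflect x.snd u, translate r (memLp_extend x.snd) s)

lemma continuous_shiftFlow {r : ℝ} (x : X r) : Continuous (shiftFlow x) :=
  (WithLp.prod_continuous_toLp 2 _ _).comp
    ((continuous_const.add (continuous_integral_reflect x.snd)).prodMk (continuous_translate r _))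

lemma shiftFlow_zero {r : ℝ} (x : X r) : shiftFlow x 0 = x := by
  refine X_ext (by simp [shiftFlow]) ?_
  change translate r (memLp_extend x.snd) 0 = x.snd
  refine Lp.ext ?_
  filter_upwards [translate_ae (memLp_extend x.snd) 0, ae_restrict_mem measurableSet_Icc]
    with ξ h1 h2
  rw [h1, sub_zero, extend, indicator_of_mem h2]

lemma integral_inner_translate {r : ℝ} (f g : L2 r) {s : ℝ} (hs : 0 ≤ s) :
    ∫ τ in 0..s, ⟪translate r (memLp_extend f) τ, g⟫_ℝ
      = ∫ ξ, (∫ u in (ξ - s)..ξ, extend f u) * extend g ξ := by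
  have h1 : Integrable (fun p : ℝ × ℝ => extend f (p.2 - p.1) * extend g p.2)
      ((volume : Measure ℝ).prod volume) := by
    have := (integrable_extend g).convolution_integrand (ContinuousLinearMap.mul ℝ ℝ)
      (integrable_reflect f) (μ := volume) (ν := volume)
    refine this.congr (ae_of_all _ fun p => ?_)
    simp [reflect, mul_comm]
  have h2 : Integrable (fun p : ℝ × ℝ => extend f (p.2 - p.1) * extend g p.2)
      ((volume.restrict (Ioc 0 s)).prod volume) :=
    h1.mono_measure (Measure.prod_mono Measure.restrict_le_self le_rfl)
  simp_rw [inner_translate]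
  rw [intervalIntegral.integral_of_le hs,
    integral_integral_swap (f := fun τ ξ => extend f (ξ - τ) * extend g ξ) h2]
  congr 1
  ext ξ
  rw [integral_mul_const, ← intervalIntegral.integral_of_le hs,
    intervalIntegral.integral_comp_sub_left (fun u => extend f u) ξ, sub_zero]

/-- The history function `ξ ↦ ∫_{ξ-s}^ξ f` is the time integral of the translates of `f`; it
vanishes at `-r` and its derivative is `f` minus its translate. -/
lemma exists_isW12_window {r : ℝ} (hr : 0 ≤ r) (f : L2 r) {s : ℝ} (hs : 0 ≤ s) :
    ∃ n : L2 r, IsW12 n (f - translate r (memLp_extend f) s)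
      (fun ξ => ∫ u in (ξ - s)..ξ, extend f u) := by
  set d : L2 r := f - translate r (memLp_extend f) s with hd
  obtain ⟨n, hn⟩ := exists_isW12 hr 0 d
  have hi : ∀ a b, IntervalIntegrable (extend f) volume a b := fun a b =>
    (integrable_extend f).intervalIntegrable
  have key : ∀ ξ ∈ Icc (-r) 0, ∫ u in (ξ - s)..ξ, extend f u = 0 + ∫ v in (-r)..ξ, d v := by
    intro ξ hξ
    have h1 : ∫ v in (-r)..ξ, d v = ∫ v in (-r)..ξ, (extend f v - extend f (v - s)) := by
      rw [intervalIntegral.integral_of_le hξ.1, intervalIntegral.integral_of_le hξ.1]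
      refine integral_congr_ae ?_
      have hsub : Ioc (-r) ξ ⊆ Icc (-r) 0 :=
        Ioc_subset_Icc_self.trans (Icc_subset_Icc_right hξ.2)
      filter_upwards [ae_restrict_of_ae_restrict_of_subset hsub
        (Lp.coeFn_sub f (translate r (memLp_extend f) s)), ae_restrict_of_ae_restrict_of_subset hsub
        (translate_ae (memLp_extend f) s), ae_restrict_mem measurableSet_Ioc] with v h2 h3 h4
      rw [hd, h2, Pi.sub_apply, h3, extend, indicator_of_mem (hsub h4)]
    have h2 : ∫ u in (-r - s)..(-r), extend f u = 0 := by
      refine intervalIntegral.integral_zero_ae ?_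
      filter_upwards [compl_mem_ae_iff.2 (measure_singleton (-r))] with u hu hu'
      rw [uIoc_of_le (by linarith)] at hu'
      refine indicator_of_notMem (fun h => hu ?_) _
      exact le_antisymm hu'.2 h.1
    rw [h1, intervalIntegral.integral_sub (hi _ _) ((integrable_extend f).comp_sub_right s
      |>.intervalIntegrable), intervalIntegral.integral_comp_sub_right (fun v => extend f v) s]
    have h3 := intervalIntegral.integral_add_adjacent_intervals (hi (-r - s) (-r)) (hi (-r) ξ)
    have h4 := intervalIntegral.integral_add_adjacent_intervals (hi (-r - s) (ξ - s)) (hi (ξ - s) ξ)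
    linarith
  refine ⟨n, ?_, fun ξ hξ => ?_⟩
  · filter_upwards [hn.1, ae_restrict_mem measurableSet_Icc] with ξ h1 h2
    rw [h1, key ξ h2]
  · have hl : -r ∈ Icc (-r) 0 := ⟨le_rfl, by linarith⟩
    dsimp only
    rw [key ξ hξ, key _ hl]
    simp

/-- The weak equation of the unperturbed evolution, whose adjoint generator is
`(F(0), F) ↦ (0, F')`. -/
lemma inner_shiftFlow {r : ℝ} (hr : 0 ≤ r) (x : X r) {f g : L2 r} {F : ℝ → ℝ} (hf : IsW12 f g F)
    {s : ℝ} (hs : 0 ≤ s) :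
    ⟪shiftFlow x s, (WithLp.toLp 2 (F 0, f) : X r)⟫_ℝ = ⟪x, (WithLp.toLp 2 (F 0, f) : X r)⟫_ℝ
      + ∫ τ in 0..s, ⟪shiftFlow x τ, (WithLp.toLp 2 (0, g) : X r)⟫_ℝ := by
  obtain ⟨n, hn⟩ := exists_isW12_window hr x.snd hs
  have h1 := hn.inner_add_inner hr hf
  have h2 : ⟪n, g⟫_ℝ = ∫ τ in 0..s, ⟪shiftFlow x τ, (WithLp.toLp 2 (0, g) : X r)⟫_ℝ := by
    have : ∀ τ, ⟪shiftFlow x τ, (WithLp.toLp 2 (0, g) : X r)⟫_ℝ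
        = ⟪translate r (memLp_extend x.snd) τ, g⟫_ℝ := fun τ => by
      simp [shiftFlow]
    simp_rw [this]
    rw [integral_inner_translate _ _ hs, L2.inner_eq, ← integral_indicator measurableSet_Icc]
    have hae := (ae_restrict_iff' measurableSet_Icc).1 hn.1
    refine integral_congr_ae ?_
    filter_upwards [hae] with ξ hξ
    by_cases h : ξ ∈ Icc (-r) 0
    · simp [extend, h, hξ h]
    · simp [extend, h]
  have h3 : ∫ u in (-r - s)..(-r), extend x.snd u = 0 := by
    refine intervalIntegral.integral_zero_ae ?_
    filter_upwards [compl_mem_ae_iff.2 (measure_singleton (-r))] with u hu hu'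
    rw [uIoc_of_le (by linarith)] at hu'
    exact indicator_of_notMem (fun h => hu (le_antisymm hu'.2 h.1)) _
  rw [h3, zero_sub, ← integral_reflect, inner_sub_left] at h1
  rw [← h2, X.inner_eq, X.inner_eq]
  simp only [shiftFlow, WithLp.toLp_fst, WithLp.toLp_snd]
  linarith

/-! ### The fundamental solution of the delay equation -/

/-- The kernel `κ(s) = a₀ + ∫_{-s}^0 a₁` of the Volterra form of the delay equation. -/
def delayKernel {r : ℝ} (a₀ : ℝ) (a₁ : L2 r) (s : ℝ) : ℝ := a₀ + ∫ u in 0..s, reflect a₁ u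

lemma continuous_delayKernel {r : ℝ} (a₀ : ℝ) (a₁ : L2 r) : Continuous (delayKernel a₀ a₁) :=
  continuous_const.add (continuous_integral_reflect a₁)

/-- `p` is the fundamental solution on `[0,T]` of the delay equation
`p'(s) = a₀ p(s) + ∫_{-r}^0 a₁(ξ) p(s + ξ) dξ`, `p(0) = 1`, `p = 0` before time `0`, written as the
Volterra equation `p = 1 + κ * p`. -/
structure IsFundamental {r : ℝ} (a₀ : ℝ) (a₁ : L2 r) (T : ℝ) (p : ℝ → ℝ) : Prop where
  continuous : Continuous p
  eq : ∀ s ∈ Icc 0 T, p s = 1 + volterra (delayKernel a₀ a₁) p s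

lemma memLp_indicator_Icc {p : ℝ → ℝ} (hp : Continuous p) (T : ℝ) :
    MemLp ((Icc 0 T).indicator p) 2 (volume : Measure ℝ) := by
  rw [memLp_indicator_iff_restrict measurableSet_Icc]
  obtain ⟨C, hC⟩ := (isCompact_Icc (a := (0 : ℝ)) (b := T)).exists_bound_of_continuousOn
    hp.continuousOn
  exact (memLp_top_of_bound hp.aestronglyMeasurable _
    ((ae_restrict_iff' measurableSet_Icc).2 (ae_of_all _ hC))).mono_exponent le_top

/-- The path `s ↦ (p(s), ξ ↦ p(s + ξ) 1_{s + ξ ∈ [0,T]})` in `X`. -/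
def segmentFlow (r T : ℝ) {p : ℝ → ℝ} (hp : Continuous p) (s : ℝ) : X r :=
  WithLp.toLp 2 (p s, translate r (memLp_indicator_Icc hp T) (-s))

lemma continuous_segmentFlow (r T : ℝ) {p : ℝ → ℝ} (hp : Continuous p) :
    Continuous (segmentFlow r T hp) :=
  (WithLp.prod_continuous_toLp 2 _ _).comp
    (hp.prodMk ((continuous_translate r _).comp continuous_neg))

/-- The pairing with the history component of `x` is a Volterra convolution with `u ↦ x₁(-u)`. -/
lemma inner_segmentFlow {r T : ℝ} {p : ℝ → ℝ} (hp : Continuous p) (x : X r) {s : ℝ}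
    (hs : s ∈ Icc 0 T) :
    ⟪segmentFlow r T hp s, x⟫_ℝ = p s * x.fst + volterra p (reflect x.snd) s := by
  rw [X.inner_eq]
  simp only [segmentFlow, WithLp.toLp_fst, WithLp.toLp_snd]
  rw [inner_translate, ← integral_neg_eq_self, volterra, intervalIntegral.integral_of_le hs.1,
    ← integral_Icc_eq_integral_Ioc, ← integral_indicator measurableSet_Icc]
  congr 2
  ext u
  rw [show -u - -s = s - u by ring]
  by_cases h : u ∈ Icc 0 s
  · have h' : s - u ∈ Icc 0 T := ⟨by linarith [h.2], by linarith [h.1, hs.2]⟩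
    rw [indicator_of_mem h, indicator_of_mem h', reflect]
  · rw [indicator_of_notMem h]
    by_cases h0 : 0 ≤ u
    · have h' : s - u ∉ Icc 0 T := fun h' => h ⟨h0, by linarith [h'.1]⟩
      rw [indicator_of_notMem h', zero_mul]
    · have h' : -u ∉ Icc (-r) 0 := fun h' => h0 (by linarith [h'.2])
      rw [extend, indicator_of_notMem h', mul_zero]

lemma integral_volterra_reflect {r : ℝ} {p : ℝ → ℝ} (hp : Continuous p) (f : L2 r) {s : ℝ}
    (hs : 0 ≤ s) : ∫ τ in 0..s, volterra p (reflect f) τ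
      = volterra p (fun τ => ∫ u in 0..τ, reflect f u) s := by
  have h1 := volterra_assoc (f := fun _ => 1) continuous_const hp hs
    (intervalIntegrable_reflect f 0 s)
  have h2 := volterra_assoc (g := fun _ => 1) hp continuous_const hs
    (intervalIntegrable_reflect f 0 s)
  have h3 : volterra p (fun _ => 1) = volterra (fun _ => 1) p := funext (volterra_comm _ _)
  rw [volterra_one] at h1
  rw [h1, ← h3, ← h2]
  congr 1
  ext τ
  rw [volterra_one]

lemma intervalIntegrable_volterra_reflect {r T : ℝ} {p : ℝ → ℝ} (hp : Continuous p) (f : L2 r)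
    {s : ℝ} (hs : s ∈ Icc 0 T) : IntervalIntegrable (volterra p (reflect f)) volume 0 s := by
  have h1 : Continuous fun τ => ⟪segmentFlow r T hp τ, (WithLp.toLp 2 (0, f) : X r)⟫_ℝ :=
    (continuous_segmentFlow r T hp).inner continuous_const
  refine (h1.intervalIntegrable 0 s).congr fun τ hτ => ?_
  rw [uIoc_of_le hs.1] at hτ
  rw [inner_segmentFlow hp _ ⟨hτ.1.le, hτ.2.trans hs.2⟩]
  simp

/-- The integrated form `1 * ⟨q, x⟩ = p * (x₀ + 1 * x₁(-·))` of `inner_segmentFlow`. -/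
lemma integral_inner_segmentFlow {r T : ℝ} {p : ℝ → ℝ} (hp : Continuous p) (x : X r) {s : ℝ}
    (hs : s ∈ Icc 0 T) : ∫ τ in 0..s, ⟪segmentFlow r T hp τ, x⟫_ℝ
      = volterra (fun τ => x.fst + ∫ u in 0..τ, reflect x.snd u) p s := by
  have h1 : ∫ τ in 0..s, ⟪segmentFlow r T hp τ, x⟫_ℝ
      = ∫ τ in 0..s, (p τ * x.fst + volterra p (reflect x.snd) τ) := by
    refine intervalIntegral.integral_congr fun τ hτ => ?_
    rw [uIcc_of_le hs.1] at hτ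
    exact inner_segmentFlow hp x ⟨hτ.1, hτ.2.trans hs.2⟩
  rw [h1, intervalIntegral.integral_add (Continuous.intervalIntegrable (by fun_prop) _ _)
    (intervalIntegrable_volterra_reflect hp _ hs), integral_volterra_reflect hp _ hs.1,
    volterra_add_left continuous_const (continuous_integral_reflect _)
      (hp.intervalIntegrable _ _), volterra_const, intervalIntegral.integral_mul_const,
    volterra_comm p]
  ring

namespace IsFundamental

variable {r a₀ T : ℝ} {a₁ : L2 r} {p : ℝ → ℝ}

/-- The delay equation of `p` in integrated form. -/
lemma eq_one_add_integral (hp : IsFundamental a₀ a₁ T p) {s : ℝ} (hs : s ∈ Icc 0 T) :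
    p s = 1 + ∫ τ in 0..s,
      ⟪segmentFlow r T hp.continuous τ, (WithLp.toLp 2 (a₀, a₁) : X r)⟫_ℝ := by
  rw [hp.eq s hs, integral_inner_segmentFlow hp.continuous _ hs]
  rfl

/-- `s ↦ ⟨q(s), x⟩`, where `q` is the segment path of the fundamental solution, solves the Volterra
equation of the head of the delay equation started at `x`. -/
lemma inner_segmentFlow_eq (hp : IsFundamental a₀ a₁ T p) (x : X r) {s : ℝ} (hs : s ∈ Icc 0 T) :
    ⟪segmentFlow r T hp.continuous s, x⟫_ℝ = x.fst + (∫ u in 0..s, reflect x.snd u)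
      + volterra (delayKernel a₀ a₁) (fun τ => ⟪segmentFlow r T hp.continuous τ, x⟫_ℝ) s := by
  have hc := hp.continuous
  have hκ := continuous_delayKernel a₀ a₁
  have hψ := intervalIntegrable_reflect x.snd 0 s
  have hsub : ∀ τ ∈ Icc 0 s, τ ∈ Icc 0 T := fun τ hτ => ⟨hτ.1, hτ.2.trans hs.2⟩
  rw [volterra_congr_right hs.1 (fun τ hτ => inner_segmentFlow hc x (hsub τ hτ)),
    inner_segmentFlow hc x hs,
    volterra_add_right hκ (Continuous.intervalIntegrable (by fun_prop) _ _)
      (intervalIntegrable_volterra_reflect hc _ hs),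
    volterra_assoc hκ hc hs.1 hψ]
  have h1 : volterra (volterra (delayKernel a₀ a₁) p) (reflect x.snd) s
      = volterra p (reflect x.snd) s - ∫ u in 0..s, reflect x.snd u := by
    rw [volterra_congr_left hs.1 (f' := fun τ => p τ + (-1)) fun τ hτ => by
      rw [hp.eq τ (hsub τ hτ)]; ring]
    rw [volterra_add_left hc continuous_const hψ, volterra_const]
    ring
  have h2 : volterra (delayKernel a₀ a₁) (fun τ => p τ * x.fst) s = x.fst * (p s - 1) := by
    simp_rw [mul_comm _ x.fst]
    rw [volterra_smul_right, hp.eq s hs]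
    ring
  rw [h1, h2]
  ring

/-- The segment path of the fundamental solution solves `q' = A* q`, `q(0) = (1,0)`, weakly. -/
lemma inner_segmentFlow_of_mem_graphA (hr : 0 < r) (hp : IsFundamental a₀ a₁ T p) {x y : X r}
    (hxy : (x, y) ∈ graphA r a₀ a₁) {s : ℝ} (hs : s ∈ Icc 0 T) :
    ⟪segmentFlow r T hp.continuous s, x⟫_ℝ
      = x.fst + ∫ τ in 0..s, ⟪segmentFlow r T hp.continuous τ, y⟫_ℝ := by
  have hc := hp.continuous
  obtain ⟨F, g, h1, h2, h3, h4⟩ := hxy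
  change y.fst = a₀ * x.fst + F 0 at h3
  change y.snd = x.fst • a₁ - g at h4
  change IsW12 x.snd g F at h1
  have hqc := continuous_segmentFlow r T hc
  have hy : y = x.fst • (WithLp.toLp 2 (a₀, a₁) : X r) + (WithLp.toLp 2 (F 0, -g) : X r) := by
    refine X_ext ?_ ?_
    · change y.fst = x.fst * a₀ + F 0
      rw [h3]; ring
    · change y.snd = x.fst • a₁ + -g
      rw [h4]; abel
  have h5 : ∫ τ in 0..s, ⟪segmentFlow r T hc τ, y⟫_ℝ
      = x.fst * (p s - 1) + volterra (fun τ => F 0 + ∫ u in 0..τ, reflect (-g) u) p s := by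
    have h6 := integral_inner_segmentFlow hc (WithLp.toLp 2 (F 0, -g) : X r) hs
    simp only [WithLp.toLp_fst, WithLp.toLp_snd] at h6
    rw [hp.eq_one_add_integral hs, ← h6, hy,
      add_sub_cancel_left, ← intervalIntegral.integral_const_mul, ← intervalIntegral.integral_add]
    · simp_rw [inner_add_right, inner_smul_right]
    · exact Continuous.intervalIntegrable (by fun_prop) _ _
    · exact Continuous.intervalIntegrable (by fun_prop) _ _
  have hr0 : -r ≤ 0 := by linarith
  -- `F(0) - ∫_{-τ}^0 F'` is `F(-τ)` up to `τ = r`, and `F(-r) = 0` afterwards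
  have hmain : ∀ τ, 0 ≤ τ → F 0 + ∫ u in 0..τ, reflect (-g) u
      = (Icc (-r) 0).indicator F (-τ) := fun τ hτ => by
    have hi : ∀ a b, IntervalIntegrable (extend (-g)) volume a b := fun a b =>
      (integrable_extend _).intervalIntegrable
    have hint : ∀ ξ ∈ Icc (-r) 0, ∫ u in (-r)..ξ, extend (-g) u = - (F ξ) := fun ξ hξ => by
      rw [h1.2 ξ hξ, h2, zero_add, ← intervalIntegral.integral_neg,
        intervalIntegral.integral_of_le hξ.1, intervalIntegral.integral_of_le hξ.1]
      have hsub : Ioc (-r) ξ ⊆ Icc (-r) 0 :=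
        Ioc_subset_Icc_self.trans (Icc_subset_Icc_right hξ.2)
      refine integral_congr_ae ?_
      filter_upwards [ae_restrict_of_ae_restrict_of_subset hsub (Lp.coeFn_neg g),
        ae_restrict_mem measurableSet_Ioc] with v h6 h7
      rw [extend, indicator_of_mem (hsub h7), h6, Pi.neg_apply]
    have h6 := intervalIntegral.integral_add_adjacent_intervals (hi (-r) (-τ)) (hi (-τ) 0)
    rw [hint 0 ⟨hr0, le_rfl⟩] at h6
    rw [integral_reflect]
    by_cases h7 : -τ ∈ Icc (-r) 0
    · rw [indicator_of_mem h7]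
      rw [hint _ h7] at h6
      linarith
    · rw [indicator_of_notMem h7]
      have h8 : -τ < -r := not_le.1 fun h => h7 ⟨h, by linarith⟩
      have h9 : ∫ u in (-r)..(-τ), extend (-g) u = 0 := by
        rw [intervalIntegral.integral_symm, neg_eq_zero]
        refine intervalIntegral.integral_zero_ae ?_
        filter_upwards [compl_mem_ae_iff.2 (measure_singleton (-r))] with u hu hu'
        rw [uIoc_of_le h8.le] at hu'
        exact indicator_of_notMem (fun h => hu (le_antisymm hu'.2 h.1)) _
      linarith
  have h6 : volterra (fun τ => F 0 + ∫ u in 0..τ, reflect (-g) u) p s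
      = volterra p (reflect x.snd) s := by
    rw [volterra_congr_left hs.1 fun τ hτ => hmain τ hτ.1, volterra_comm]
    refine intervalIntegral.integral_congr_ae ?_
    have h7 := (ae_restrict_iff' measurableSet_Icc).1 h1.1
    have h8 := (Measure.measurePreserving_neg (volume : Measure ℝ)).quasiMeasurePreserving.ae h7
    filter_upwards [h8] with τ h9 _
    congr 1
    rw [reflect, extend]
    by_cases h10 : -τ ∈ Icc (-r) 0
    · rw [indicator_of_mem h10, indicator_of_mem h10, h9 h10]
    · rw [indicator_of_notMem h10, indicator_of_notMem h10]
  rw [h5, h6, inner_segmentFlow hc x hs]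
  ring

end IsFundamental

/-! ### The delay semigroup -/

/-- The solution of `u' = A u`, `u(0) = x`, by variation of constants: `A` is the generator of
`shiftFlow` plus the rank one perturbation `x ↦ x₀ (a₀, a₁)`, and the head of `u(s)` is
`⟨q(s), x⟩` with `q` the segment path of the fundamental solution. -/
def delayFlow {r : ℝ} (a₀ : ℝ) (a₁ : L2 r) (T : ℝ) {p : ℝ → ℝ} (hp : Continuous p) (x : X r)
    (s : ℝ) : X r :=
  shiftFlow x s + duhamel (fun τ => ⟪segmentFlow r T hp τ, x⟫_ℝ)
    (shiftFlow (WithLp.toLp 2 (a₀, a₁))) s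

section delayFlow

variable {r a₀ T : ℝ} {a₁ : L2 r} {p : ℝ → ℝ}

lemma continuous_inner_segmentFlow (hp : Continuous p) (x : X r) :
    Continuous fun τ => ⟪segmentFlow r T hp τ, x⟫_ℝ :=
  (continuous_segmentFlow r T hp).inner continuous_const

lemma continuous_delayFlow (hp : Continuous p) (x : X r) :
    Continuous (delayFlow a₀ a₁ T hp x) := by
  refine (continuous_shiftFlow x).add ?_
  have h1 := continuous_inner_segmentFlow (T := T) hp x
  have h2 := continuous_shiftFlow (WithLp.toLp 2 (a₀, a₁) : X r)
  exact intervalIntegral.continuous_parametric_intervalIntegral_of_continuous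
    (f := fun s τ => ⟪segmentFlow r T hp τ, x⟫_ℝ • shiftFlow (WithLp.toLp 2 (a₀, a₁) : X r) (s - τ))
    ((h1.comp continuous_snd).smul (h2.comp (continuous_fst.sub continuous_snd))) continuous_id

lemma delayFlow_zero (hp : Continuous p) (x : X r) : delayFlow a₀ a₁ T hp x 0 = x := by
  simp [delayFlow, duhamel, shiftFlow_zero]

/-- The duality `⟨u_x(s), (1,0)⟩ = ⟨x, q(s)⟩` between the two evolutions. -/
lemma fst_delayFlow (hp : IsFundamental a₀ a₁ T p) (x : X r) {s : ℝ} (hs : s ∈ Icc 0 T) :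
    (delayFlow a₀ a₁ T hp.continuous x s).fst = ⟪segmentFlow r T hp.continuous s, x⟫_ℝ := by
  have h1 : ∀ y : X r, y.fst = ⟪y, (WithLp.toLp 2 (1, 0) : X r)⟫_ℝ := fun y => by
    simp
  rw [h1, delayFlow, inner_add_left, inner_duhamel (continuous_shiftFlow _)
    ((continuous_inner_segmentFlow hp.continuous x).intervalIntegrable _ _),
    hp.inner_segmentFlow_eq x hs, ← h1]
  simp_rw [← h1]
  rfl

/-- `delayFlow` is a weak solution of `u' = A u`, `u(0) = x`. -/
lemma inner_delayFlow (hr : 0 < r) (hp : IsFundamental a₀ a₁ T p) (x : X r) {ζ η : X r}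
    (h : (ζ, η) ∈ graphAstar r a₀ a₁) {s : ℝ} (hs : s ∈ Icc 0 T) :
    ⟪delayFlow a₀ a₁ T hp.continuous x s, ζ⟫_ℝ
      = ⟪x, ζ⟫_ℝ + ∫ τ in 0..s, ⟪delayFlow a₀ a₁ T hp.continuous x τ, η⟫_ℝ := by
  obtain ⟨F, h1, h2, h3⟩ := h
  change ζ.fst = F 0 at h2
  change η.fst = a₀ * ζ.fst + ⟪a₁, ζ.snd⟫_ℝ at h3
  change IsW12 ζ.snd η.snd F at h1
  set k : X r := WithLp.toLp 2 (a₀, a₁)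
  have hζ : ζ = WithLp.toLp 2 (F 0, ζ.snd) := X_ext h2 rfl
  set η' : X r := WithLp.toLp 2 (0, η.snd)
  have hη : ∀ y : X r, ⟪y, η⟫_ℝ = ⟪k, ζ⟫_ℝ * y.fst + ⟪y, η'⟫_ℝ := fun y => by
    rw [X.inner_eq, X.inner_eq, X.inner_eq, h3]
    simp only [k, η', WithLp.toLp_fst, WithLp.toLp_snd]
    ring
  have hS : ∀ y : X r, ∀ τ, 0 ≤ τ → ⟪shiftFlow y τ, ζ⟫_ℝ
      = ⟪y, ζ⟫_ℝ + ∫ v in 0..τ, ⟪shiftFlow y v, η'⟫_ℝ := fun y τ hτ => by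
    have := inner_shiftFlow hr.le y h1 hτ
    rwa [← hζ] at this
  have hqc := continuous_inner_segmentFlow (T := T) hp.continuous x
  have hUc := continuous_delayFlow (a₀ := a₀) (a₁ := a₁) (T := T) hp.continuous x
  have hSc := continuous_shiftFlow x
  have hdc : Continuous (duhamel (fun τ => ⟪segmentFlow r T hp.continuous τ, x⟫_ℝ) (shiftFlow k)) :=
    by simpa [delayFlow, k, Pi.sub_def] using hUc.sub hSc
  have h4 := inner_duhamel_eq (continuous_shiftFlow k) (hqc.intervalIntegrable 0 T) (ζ := ζ)
    (η := η') (fun τ hτ => by rw [hS k τ hτ.1, shiftFlow_zero]) s hs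
  rw [shiftFlow_zero] at h4
  have h5 : ∫ τ in 0..s, ⟪delayFlow a₀ a₁ T hp.continuous x τ, η⟫_ℝ
      = ∫ τ in 0..s, (⟪k, ζ⟫_ℝ * ⟪segmentFlow r T hp.continuous τ, x⟫_ℝ + (⟪shiftFlow x τ, η'⟫_ℝ +
        ⟪duhamel (fun τ => ⟪segmentFlow r T hp.continuous τ, x⟫_ℝ) (shiftFlow k) τ, η'⟫_ℝ)) := by
    refine intervalIntegral.integral_congr fun τ hτ => ?_
    rw [uIcc_of_le hs.1] at hτ
    rw [hη, fst_delayFlow hp x ⟨hτ.1, hτ.2.trans hs.2⟩, delayFlow, inner_add_left]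
  rw [h5, intervalIntegral.integral_add, intervalIntegral.integral_add,
    intervalIntegral.integral_const_mul, delayFlow, inner_add_left, h4, hS x s hs.1]
  · ring
  all_goals exact Continuous.intervalIntegrable (by fun_prop) _ _

end delayFlow

/-! ### The Hamiltonian -/

section Hamiltonian

variable {E : Type*} [NormedAddCommGroup E] [InnerProductSpace ℝ E]

/-- The concave quadratic `z ↦ z b - β z²` on `[0,∞)` is at most its value at
`max b 0 / (2 β)`. -/
lemma mul_sub_sq_le {β z : ℝ} (hβ : 0 < β) (hz : 0 ≤ z) (b : ℝ) :
    z * b - β * z ^ 2 ≤ (max b 0) ^ 2 / (4 * β) := by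
  rw [le_div_iff₀ (by linarith)]
  have h1 : z * b ≤ z * max b 0 := mul_le_mul_of_nonneg_left (le_max_left _ _) hz
  nlinarith [sq_nonneg (2 * β * z - max b 0), mul_le_mul_of_nonneg_left h1 hβ.le]

lemma mul_sub_sq_maximizer {β : ℝ} (hβ : 0 < β) (b : ℝ) :
    max b 0 / (2 * β) * b - β * (max b 0 / (2 * β)) ^ 2 = (max b 0) ^ 2 / (4 * β) := by
  rcases le_total b 0 with h | h
  · simp [max_eq_right h]
  · rw [max_eq_left h]
    field_simp
    ring

lemma isGreatest_hamiltonianValues {β : ℝ} (hβ : 0 < β) (B p : E) :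
    IsGreatest (hamiltonianValues B (fun z => -β * z ^ 2) p)
      (⟪(max ⟪B, p⟫_ℝ 0 / (2 * β)) • B, p⟫_ℝ + -β * (max ⟪B, p⟫_ℝ 0 / (2 * β)) ^ 2) := by
  have h0 : 0 ≤ max ⟪B, p⟫_ℝ 0 / (2 * β) := div_nonneg (le_max_right _ _) (by linarith)
  refine ⟨⟨_, h0, rfl⟩, ?_⟩
  rintro _ ⟨z, hz, rfl⟩
  have h1 := mul_sub_sq_le hβ hz ⟪B, p⟫_ℝ
  have h2 := mul_sub_sq_maximizer hβ ⟪B, p⟫_ℝ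
  simp only [inner_smul_left, conj_trivial]
  linarith

lemma hamiltonian_eq {β : ℝ} (hβ : 0 < β) (B p : E) :
    hamiltonian B (fun z => -β * z ^ 2) p = (max ⟪B, p⟫_ℝ 0) ^ 2 / (4 * β) := by
  rw [hamiltonian, (isGreatest_hamiltonianValues hβ B p).csSup_eq, ← mul_sub_sq_maximizer hβ,
    inner_smul_left, conj_trivial]
  ring

end Hamiltonian

/-! ### The adjoint equation and the Hamilton-Jacobi-Bellman equation -/

lemma IsAdjointSolution.integral_inner {E : Type*} [NormedAddCommGroup E]
    [InnerProductSpace ℝ E] {A : E →ₗ.[ℝ] E} {T : ℝ} {wT : E} {w : ℝ → E}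
    (hw : IsAdjointSolution A T wT w) (x : A.domain) {t : ℝ} (ht : t ∈ Icc 0 T) :
    ∫ s in t..T, ⟪w s, A x⟫_ℝ = ⟪w t, (x : E)⟫_ℝ - ⟪wT, (x : E)⟫_ℝ := by
  have hsub : Icc t T ⊆ Icc 0 T := Icc_subset_Icc_left ht.1
  have hc : ContinuousOn (fun s => ⟪w s, A x⟫_ℝ) (uIcc t T) := by
    rw [uIcc_of_le ht.2]
    exact (hw.continuousOn.mono hsub).inner continuousOn_const
  have h1 := intervalIntegral.integral_eq_sub_of_hasDerivAt_of_le (f := fun s => ⟪w s, (x : E)⟫_ℝ)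
    (f' := fun s => -⟪w s, A x⟫_ℝ) ht.2 ((hw.continuousOn.mono hsub).inner continuousOn_const)
    (fun s hs => (hw.hasDeriv x s (hsub (Ioo_subset_Icc_self hs))).hasDerivAt
      (Icc_mem_nhds (ht.1.trans_lt hs.1) hs.2)) hc.neg.intervalIntegrable
  rw [intervalIntegral.integral_neg, hw.terminal] at h1
  linarith

section Adjoint

variable {E : Type*} [NormedAddCommGroup E] [InnerProductSpace ℝ E] [CompleteSpace E]

/-- Uniqueness for the backward equation `w' + A* w = 0`, `w(T) = wT`. -/
lemma IsAdjointSolution.eqOn {A : E →ₗ.[ℝ] E} {T C : ℝ} {wT : E} {w w' : ℝ → E}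
    (hw : IsAdjointSolution A T wT w) (hw' : IsAdjointSolution A T wT w')
    (hdiss : ∀ m d : E, (∀ p ∈ A.graph, ⟪d, p.1⟫_ℝ = ⟪m, p.2⟫_ℝ) → ⟪d, m⟫_ℝ ≤ C * ‖m‖ ^ 2)
    (hsep : ∀ d : E, (∀ p ∈ A.graph, ⟪d, p.1⟫_ℝ = 0) → d = 0) (hT : 0 ≤ T) :
    EqOn w' w (Icc 0 T) := by
  have hmaps : MapsTo (fun s => T - s) (Icc 0 T) (Icc 0 T) := fun s hs =>
    ⟨by linarith [hs.2], by linarith [hs.1]⟩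
  have hcomp : ∀ {u : ℝ → E}, ContinuousOn u (Icc 0 T) →
      ContinuousOn (fun s => u (T - s)) (Icc 0 T) := fun hu =>
    hu.comp (by fun_prop) hmaps
  have hc := (hcomp hw'.continuousOn).sub (hcomp hw.continuousOn)
  have key := eq_zero_of_weak_homogeneous (Γ := (A.graph : Set (E × E))) hT hc ?_ hdiss hsep
  · intro t ht
    have h1 := key (T - t) (hmaps ht)
    simp only [Pi.sub_apply, sub_sub_cancel] at h1
    exact sub_eq_zero.1 h1
  · rintro p hp s hs
    obtain ⟨x, rfl⟩ := (LinearPMap.mem_graph_iff' A).1 hp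
    have hi : ∀ {u : ℝ → E}, ContinuousOn u (Icc 0 T) →
        IntervalIntegrable (fun τ => ⟪u (T - τ), A x⟫_ℝ) volume 0 s := fun hu => by
      refine ContinuousOn.intervalIntegrable ?_
      rw [uIcc_of_le hs.1]
      exact ((hcomp hu).mono (Icc_subset_Icc_right hs.2)).inner continuousOn_const
    have h1 := hw.integral_inner x (hmaps hs)
    have h2 := hw'.integral_inner x (hmaps hs)
    simp only [Pi.sub_apply, inner_sub_left]
    rw [intervalIntegral.integral_sub (hi hw'.continuousOn) (hi hw.continuousOn),
      intervalIntegral.integral_comp_sub_left (fun τ => ⟪w τ, A x⟫_ℝ) T,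
      intervalIntegral.integral_comp_sub_left (fun τ => ⟪w' τ, A x⟫_ℝ) T, sub_zero, h1, h2]
    ring

lemma grad_affine (w : ℝ → E) (c : ℝ → ℝ) (t : ℝ) (x : E) :
    grad (fun t x => ⟪w t, x⟫_ℝ + c t) t x = w t := by
  refine HasGradientAt.gradient ?_
  rw [hasGradientAt_iff_hasFDerivAt]
  exact (innerSL ℝ (w t)).hasFDerivAt.add_const (c t)

lemma hess_affine (w : ℝ → E) (c : ℝ → ℝ) (t : ℝ) (x : E) :
    hess (fun t x => ⟪w t, x⟫_ℝ + c t) t x = 0 := by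
  rw [hess, funext (grad_affine w c t)]
  simp

/-- If `w' + A* w = 0` and `c' + H₀(w) = 0`, the affine function `⟨w(t), x⟩ + c(t)` is an integral
solution of the HJB equation: the second order term vanishes on it. -/
theorem isIntegralSolution_affine {A : E →ₗ.[ℝ] E} {Q : E →L[ℝ] E} {H₀ φ : E → ℝ} {T : ℝ}
    {wT : E} {w : ℝ → E} {c : ℝ → ℝ} (hw : IsAdjointSolution A T wT w)
    (hφ : ∀ x, φ x = ⟪wT, x⟫_ℝ) (hH : Continuous H₀)
    (hc : ∀ t ∈ Icc 0 T, HasDerivWithinAt c (-(H₀ (w t))) (Icc 0 T) t) (hcT : c T = 0) :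
    IsIntegralSolution A Q H₀ φ T (fun t x => ⟪w t, x⟫_ℝ + c t) := by
  have hcc : ContinuousOn c (Icc 0 T) := fun t ht => (hc t ht).continuousWithinAt
  have hw1 : ContinuousOn (fun p : ℝ × E => w p.1) (Icc 0 T ×ˢ univ) :=
    hw.continuousOn.comp continuousOn_fst fun p hp => hp.1
  have hint : ∀ x : A.domain, hjbIntegrand A Q H₀ (fun t x => ⟪w t, x⟫_ℝ + c t) x
      = fun s => ⟪w s, A x⟫_ℝ + H₀ (w s) := fun x => by
    ext s
    rw [hjbIntegrand, hess_affine, grad_affine, real_inner_comm]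
    simp [trace]
  have hHw : ContinuousOn (fun s => H₀ (w s)) (Icc 0 T) := hH.comp_continuousOn hw.continuousOn
  have hwA : ∀ x : A.domain, ContinuousOn (fun s => ⟪w s, A x⟫_ℝ) (Icc 0 T) := fun x =>
    hw.continuousOn.inner continuousOn_const
  have hii : ∀ {f : ℝ → ℝ}, ContinuousOn f (Icc 0 T) → ∀ t ∈ Icc 0 T,
      IntervalIntegrable f volume t T := fun hf t ht => by
    refine ContinuousOn.intervalIntegrable ?_
    rw [uIcc_of_le ht.2]
    exact hf.mono (Icc_subset_Icc_left ht.1)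
  refine ⟨⟨fun t _ => ?_, ?_, ?_, ?_⟩, fun t ht x => ?_, fun t ht x => ?_⟩
  · exact (innerSL ℝ (w t)).contDiff.add contDiff_const
  · exact (hw1.inner continuousOn_snd).add (hcc.comp continuousOn_fst fun p hp => hp.1)
  · simp_rw [grad_affine]
    exact hw1
  · simp_rw [hess_affine]
    exact continuousOn_const
  · rw [hint]
    exact hii ((hwA x).add hHw) t ht
  · have h1 := intervalIntegral.integral_eq_sub_of_hasDerivAt_of_le (f := c)
      (f' := fun s => -H₀ (w s)) ht.2 (hcc.mono (Icc_subset_Icc_left ht.1))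
      (fun s hs => (hc s ⟨ht.1.trans hs.1.le, hs.2.le⟩).hasDerivAt
        (Icc_mem_nhds (ht.1.trans_lt hs.1) hs.2)) (hii hHw.neg t ht)
    rw [intervalIntegral.integral_neg, hcT] at h1
    rw [hint, intervalIntegral.integral_add (hii (hwA x) t ht) (hii hHw t ht),
      hw.integral_inner x ht, hφ]
    linarith

end Adjoint

/-! ### The adjoint equation of the delay operator -/

section AdjointDelay

variable {r a₀ T : ℝ} {a₁ : L2 r} {p : ℝ → ℝ}

lemma segmentFlow_zero (hT : 0 ≤ T) (hp : IsFundamental a₀ a₁ T p) :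
    segmentFlow r T hp.continuous 0 = WithLp.toLp 2 (1, 0) := by
  refine X_ext ?_ (Lp.ext ?_)
  · change p 0 = 1
    rw [hp.eq 0 ⟨le_rfl, hT⟩]
    simp [volterra]
  · change translate r _ (-0) =ᵐ[_] (0 : L2 r)
    filter_upwards [translate_ae (r := r) (memLp_indicator_Icc hp.continuous T) (-0),
      Lp.coeFn_zero ℝ 2 (volume.restrict (Icc (-r) 0)), ae_restrict_mem measurableSet_Icc,
      ae_restrict_of_ae (compl_mem_ae_iff.2 (measure_singleton (0 : ℝ)))] with ξ h1 h2 h3 h4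
    rw [h1, h2]
    exact indicator_of_notMem (fun h => h4 (le_antisymm h3.2 (by simpa using h.1))) _

/-- The backward path `w(t) = γ q(T - t)`. -/
def adjointFlow (r T γ : ℝ) (hp : Continuous p) (t : ℝ) : X r := γ • segmentFlow r T hp (T - t)

lemma continuous_adjointFlow (γ : ℝ) (hp : Continuous p) :
    Continuous (adjointFlow r T γ hp) :=
  ((continuous_segmentFlow r T hp).comp (by fun_prop)).const_smul γ

lemma isAdjointSolution_adjointFlow (hr : 0 < r) (hT : 0 ≤ T) (hp : IsFundamental a₀ a₁ T p)
    (γ : ℝ) : IsAdjointSolution (opA r a₀ a₁) T (WithLp.toLp 2 (γ, 0))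
      (adjointFlow r T γ hp.continuous) := by
  refine ⟨(continuous_adjointFlow γ hp.continuous).continuousOn, fun x t ht => ?_, ?_⟩
  · have hx : ((x : X r), opA r a₀ a₁ x) ∈ graphA r a₀ a₁ := by
      rw [← opA_graph hr]
      exact LinearPMap.mem_graph _ x
    set y := opA r a₀ a₁ x
    have hc := continuous_inner_segmentFlow (T := T) hp.continuous y
    have h1 : HasDerivAt (fun s => γ * ((x : X r).fst
        + ∫ τ in 0..(T - s), ⟪segmentFlow r T hp.continuous τ, y⟫_ℝ))
        (γ * (⟪segmentFlow r T hp.continuous (T - t), y⟫_ℝ * -1)) t := by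
      have h2 : HasDerivAt (fun s => T - s) (-1) t := by
        simpa using (hasDerivAt_id t).const_sub T
      exact ((((hc.integral_hasStrictDerivAt 0 (T - t)).hasDerivAt).comp t h2).const_add _).const_mul γ
    have h3 : -⟪adjointFlow r T γ hp.continuous t, y⟫_ℝ
        = γ * (⟪segmentFlow r T hp.continuous (T - t), y⟫_ℝ * -1) := by
      rw [adjointFlow, inner_smul_left, conj_trivial]
      ring
    have h4 : ∀ s ∈ Icc 0 T, ⟪adjointFlow r T γ hp.continuous s, (x : X r)⟫_ℝ
        = γ * ((x : X r).fst + ∫ τ in 0..(T - s), ⟪segmentFlow r T hp.continuous τ, y⟫_ℝ) :=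
      fun s hs => by
        rw [adjointFlow, inner_smul_left, conj_trivial, hp.inner_segmentFlow_of_mem_graphA hr hx
          ⟨by linarith [hs.2], by linarith [hs.1]⟩]
    rw [h3]
    exact h1.hasDerivWithinAt.congr h4 (h4 t ht)
  · rw [adjointFlow, sub_self, segmentFlow_zero hT hp]
    refine X_ext ?_ ?_
    · change γ * 1 = γ
      ring
    · change γ • (0 : L2 r) = 0
      simp

lemma hasDerivWithinAt_fst_adjointFlow (hr : 0 < r) (hp : IsFundamental a₀ a₁ T p) (γ : ℝ)
    {t : ℝ} (ht : t ∈ Icc 0 T) :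
    HasDerivWithinAt (fun s => (adjointFlow r T γ hp.continuous s).fst)
      (-(a₀ * (adjointFlow r T γ hp.continuous t).fst
        + ∫ ξ in (-r)..0, a₁ ξ * (adjointFlow r T γ hp.continuous t).snd ξ)) (Icc 0 T) t := by
  set k : X r := WithLp.toLp 2 (a₀, a₁) with hk
  have hc := continuous_inner_segmentFlow (T := T) hp.continuous k
  have h1 : HasDerivAt (fun s => γ * (1
      + ∫ τ in 0..(T - s), ⟪segmentFlow r T hp.continuous τ, k⟫_ℝ))
      (γ * (⟪segmentFlow r T hp.continuous (T - t), k⟫_ℝ * -1)) t := by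
    have h2 : HasDerivAt (fun s => T - s) (-1) t := by
      simpa using (hasDerivAt_id t).const_sub T
    exact ((((hc.integral_hasStrictDerivAt 0 (T - t)).hasDerivAt).comp t h2).const_add _).const_mul γ
  have h3 : -(a₀ * (adjointFlow r T γ hp.continuous t).fst
        + ∫ ξ in (-r)..0, a₁ ξ * (adjointFlow r T γ hp.continuous t).snd ξ)
      = γ * (⟪segmentFlow r T hp.continuous (T - t), k⟫_ℝ * -1) := by
    rw [← L2.inner_eq_intervalIntegral hr.le]
    have h4 : ⟪adjointFlow r T γ hp.continuous t, k⟫_ℝ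
        = γ * ⟪segmentFlow r T hp.continuous (T - t), k⟫_ℝ := by
      rw [adjointFlow, inner_smul_left, conj_trivial]
    rw [real_inner_comm, X.inner_eq] at h4
    simp only [hk, WithLp.toLp_fst, WithLp.toLp_snd] at h4
    linarith
  have h5 : ∀ s ∈ Icc 0 T, (adjointFlow r T γ hp.continuous s).fst
      = γ * (1 + ∫ τ in 0..(T - s), ⟪segmentFlow r T hp.continuous τ, k⟫_ℝ) := fun s hs => by
    change γ * p (T - s) = _
    rw [hp.eq_one_add_integral ⟨by linarith [hs.2], by linarith [hs.1]⟩]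
  rw [h3]
  exact h1.hasDerivWithinAt.congr h5 (h5 t ht)

lemma snd_adjointFlow_ae (hp : Continuous p) (γ : ℝ) (t : ℝ) :
    ∀ᵐ ξ ∂(volume.restrict (Icc (-r) 0)), (adjointFlow r T γ hp t).snd ξ
      = (Icc 0 T).indicator (fun s => (adjointFlow r T γ hp s).fst) (t - ξ) := by
  have h1 : (adjointFlow r T γ hp t).snd
      = γ • translate r (memLp_indicator_Icc hp T) (-(T - t)) := rfl
  rw [h1]
  filter_upwards [Lp.coeFn_smul γ (translate r (memLp_indicator_Icc hp T) (-(T - t))),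
    translate_ae (memLp_indicator_Icc hp T) (-(T - t))] with ξ h2 h3
  rw [h2, Pi.smul_apply, h3, smul_eq_mul]
  have h4 : ξ - -(T - t) = T - (t - ξ) := by ring
  rw [h4]
  by_cases h : t - ξ ∈ Icc 0 T
  · have h' : T - (t - ξ) ∈ Icc 0 T := ⟨by linarith [h.2], by linarith [h.1]⟩
    rw [indicator_of_mem h, indicator_of_mem h']
    rfl
  · have h' : T - (t - ξ) ∉ Icc 0 T := fun h' => h ⟨by linarith [h'.2], by linarith [h'.1]⟩
    rw [indicator_of_notMem h, indicator_of_notMem h', mul_zero]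

end AdjointDelay

/-! ### Mild solutions of the forced equation -/

section Mild

variable {E : Type*} [NormedAddCommGroup E] [InnerProductSpace ℝ E]

/-- The mild solution of `dY = (A Y + ψ B) ds + e dn`. Here `u`, `vB`, `vk` are the solutions of
the homogeneous equation started at the initial state, at `B`, and at `k = A e`; the noise term is
integrated by parts, which is possible since `e` is in the domain of `A`. -/
def mildPath (u vB vk : ℝ → E) (e : E) (ψ n : ℝ → ℝ) (s : ℝ) : E :=
  u s + duhamel ψ vB s + n s • e + duhamel n vk s

variable [CompleteSpace E]

lemma continuousOn_mildPath {u vB vk : ℝ → E} (hu : Continuous u) (hvB : Continuous vB)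
    (hvk : Continuous vk) (e : E) {ψ n : ℝ → ℝ} (hn : Continuous n) {S : ℝ} (hS : 0 ≤ S)
    (hψ : IntervalIntegrable ψ volume 0 S) :
    ContinuousOn (mildPath u vB vk e ψ n) (Icc 0 S) :=
  ((hu.continuousOn.add (continuousOn_duhamel hvB hS hψ)).add
    (hn.smul continuous_const).continuousOn).add
    (continuousOn_duhamel hvk hS (hn.intervalIntegrable _ _))

lemma inner_mildPath {u vB vk : ℝ → E} (hu : Continuous u) (hvB : Continuous vB)
    (hvk : Continuous vk) {e : E} {ψ n : ℝ → ℝ} (hn : Continuous n) {S : ℝ}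
    (hψ : IntervalIntegrable ψ volume 0 S) {ζ η : E}
    (hu' : ∀ s ∈ Icc 0 S, ⟪u s, ζ⟫_ℝ = ⟪u 0, ζ⟫_ℝ + ∫ τ in 0..s, ⟪u τ, η⟫_ℝ)
    (hvB' : ∀ s ∈ Icc 0 S, ⟪vB s, ζ⟫_ℝ = ⟪vB 0, ζ⟫_ℝ + ∫ τ in 0..s, ⟪vB τ, η⟫_ℝ)
    (hvk' : ∀ s ∈ Icc 0 S, ⟪vk s, ζ⟫_ℝ = ⟪vk 0, ζ⟫_ℝ + ∫ τ in 0..s, ⟪vk τ, η⟫_ℝ)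
    (hk : ⟪vk 0, ζ⟫_ℝ = ⟪e, η⟫_ℝ) {s : ℝ} (hs : s ∈ Icc 0 S) :
    ⟪mildPath u vB vk e ψ n s, ζ⟫_ℝ = ⟪u 0, ζ⟫_ℝ
      + (∫ τ in 0..s, (⟪mildPath u vB vk e ψ n τ, η⟫_ℝ + ⟪ψ τ • vB 0, ζ⟫_ℝ))
      + n s * ⟪e, ζ⟫_ℝ := by
  have hS : 0 ≤ S := hs.1.trans hs.2
  have hni : ∀ b, IntervalIntegrable n volume 0 b := fun b => hn.intervalIntegrable _ _
  have hsub : uIcc 0 s ⊆ Icc 0 S := by rw [uIcc_of_le hs.1]; exact Icc_subset_Icc_right hs.2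
  have hi1 : IntervalIntegrable (fun τ => ⟪u τ, η⟫_ℝ) volume 0 s :=
    (hu.inner continuous_const).intervalIntegrable _ _
  have hi2 : IntervalIntegrable (fun τ => ⟪duhamel ψ vB τ, η⟫_ℝ) volume 0 s :=
    (((continuousOn_duhamel hvB hS hψ).mono hsub).inner continuousOn_const).intervalIntegrable
  have hi3 : IntervalIntegrable (fun τ => n τ * ⟪e, η⟫_ℝ) volume 0 s :=
    (hn.mul continuous_const).intervalIntegrable _ _
  have hi4 : IntervalIntegrable (fun τ => ⟪duhamel n vk τ, η⟫_ℝ) volume 0 s :=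
    (((continuousOn_duhamel hvk hS (hni S)).mono hsub).inner continuousOn_const).intervalIntegrable
  have hi5 : IntervalIntegrable (fun τ => ψ τ * ⟪vB 0, ζ⟫_ℝ) volume 0 s :=
    (intervalIntegrable_of_mem_Icc hψ hs).mul_const _
  have h1 := inner_duhamel_eq hvB hψ hvB' s hs
  have h2 := inner_duhamel_eq hvk (hni S) hvk' s hs
  simp only [mildPath, inner_add_left, inner_smul_left, conj_trivial]
  rw [intervalIntegral.integral_add (((hi1.add hi2).add hi3).add hi4) hi5,
    intervalIntegral.integral_add ((hi1.add hi2).add hi3) hi4,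
    intervalIntegral.integral_add (hi1.add hi2) hi3, intervalIntegral.integral_add hi1 hi2,
    h1, h2, hu' s hs, intervalIntegral.integral_mul_const, intervalIntegral.integral_mul_const, hk]
  ring

end Mild

/-! ### Measurability of forced paths -/

/-- Time integrals up to `b` of a process that is jointly measurable on `[a,b] × Ω` are measurable.
The σ-algebra on `Ω` is meant to be a member of the filtration. -/
lemma stronglyMeasurable_integral_smul {Ω E : Type*} [MeasurableSpace Ω] [NormedAddCommGroup E]
    [NormedSpace ℝ E] {f : ℝ → Ω → ℝ} {a t b : ℝ}
    (hf : Measurable fun p : Icc a b × Ω => f p.1 p.2) {g : ℝ → E} (hg : Continuous g)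
    (hat : a ≤ t) (htb : t ≤ b) :
    StronglyMeasurable fun ω => ∫ τ in t..b, f τ ω • g τ := by
  have hemb : MeasurableEmbedding (fun p : Icc a b × Ω => ((p.1 : ℝ), p.2)) :=
    (MeasurableEmbedding.subtype_coe measurableSet_Icc).prodMap MeasurableEmbedding.id
  set f' : ℝ × Ω → ℝ := Function.extend (fun p : Icc a b × Ω => ((p.1 : ℝ), p.2))
    (fun p => f p.1 p.2) 0
  have hf' : Measurable f' := hemb.measurable_extend hf measurable_const
  have hff' : ∀ τ ∈ Icc a b, ∀ ω, f' (τ, ω) = f τ ω := fun τ hτ ω =>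
    hemb.injective.extend_apply (fun p => f p.1 p.2) 0 (⟨τ, hτ⟩, ω)
  have h1 : StronglyMeasurable fun p : ℝ × Ω => f' p • g p.1 :=
    hf'.stronglyMeasurable.smul (hg.stronglyMeasurable.comp_measurable measurable_fst)
  have h2 := StronglyMeasurable.integral_prod_left (μ := volume.restrict (Ioc t b))
    (f := fun τ ω => f' (τ, ω) • g τ) h1
  convert h2 using 1
  ext ω
  rw [intervalIntegral.integral_of_le htb]
  refine setIntegral_congr_fun measurableSet_Ioc fun τ hτ => ?_
  rw [hff' τ ⟨hat.trans hτ.1.le, hτ.2⟩]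

/-- A modification of Brownian motion, on a null event, with all paths continuous; it is adapted
because the filtration is complete. -/
lemma exists_continuous_modification {Ω : Type*} {mΩ : MeasurableSpace Ω} {P : Measure Ω}
    {W : ℝ≥0 → Ω → ℝ} (hWm : ∀ s, Measurable (W s)) (hW : ∀ᵐ ω ∂P, Continuous (W · ω)) :
    ∃ W' : ℝ≥0 → Ω → ℝ, (∀ ω, Continuous (W' · ω)) ∧
      (∀ s, Measurable[brownianFiltration P W hWm s] (W' s)) ∧
      ∀ᵐ ω ∂P, ∀ s, W' s ω = W s ω := by
  set N : Set Ω := toMeasurable P {ω | ¬ Continuous (W · ω)}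
  have hN0 : P N = 0 := (measure_toMeasurable _).trans hW
  have hNm : MeasurableSet N := measurableSet_toMeasurable _ _
  refine ⟨fun s => Nᶜ.indicator (W s), fun ω => ?_, fun s => ?_, ?_⟩
  · by_cases h : ω ∈ N
    · simp only [indicator_of_notMem (notMem_compl_iff.2 h)]
      exact continuous_const
    · simp only [indicator_of_mem (mem_compl h)]
      by_contra h'
      exact h (subset_toMeasurable P _ h')
  · have h1 : Measurable[brownianFiltration P W hWm s] (W s) :=
      (((Filtration.stronglyAdapted_natural fun s => (hWm s).stronglyMeasurable) s).measurable).mono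
        le_sup_left le_rfl
    have h2 : MeasurableSet[brownianFiltration P W hWm s] N :=
      le_sup_right (a := Filtration.natural W (fun s => (hWm s).stronglyMeasurable) s) N
        (MeasurableSpace.measurableSet_generateFrom ⟨hNm, hN0⟩)
    exact h1.indicator h2.compl
  · filter_upwards [compl_mem_ae_iff.2 hN0] with ω h s
    exact indicator_of_mem h _

/-- Continuous adapted processes are progressively measurable. -/
lemma measurable_uncurry_Icc {Ω : Type*} {mΩ : MeasurableSpace Ω} {𝔽 : Filtration ℝ≥0 mΩ}
    {W : ℝ≥0 → Ω → ℝ} (hc : ∀ ω, Continuous (W · ω)) (hm : ∀ s, Measurable[𝔽 s] (W s)) (s : ℝ) :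
    Measurable[(inferInstance : MeasurableSpace (Icc (0 : ℝ) s)).prod (𝔽 s.toNNReal)]
      (fun p : Icc (0 : ℝ) s × Ω => W (p.1 : ℝ).toNNReal p.2) := by
  let _ : MeasurableSpace Ω := 𝔽 s.toNNReal
  refine measurable_uncurry_of_continuous_of_measurable
    (u := fun (τ : Icc (0 : ℝ) s) ω => W (τ : ℝ).toNNReal ω) (fun ω => ?_) fun τ => ?_
  · exact (hc ω).comp (continuous_real_toNNReal.comp continuous_subtype_val)
  · exact (hm _).mono (𝔽.mono (Real.toNNReal_le_toNNReal τ.2.2)) le_rfl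

lemma duhamel_shift {E : Type*} [NormedAddCommGroup E] [InnerProductSpace ℝ E] (f : ℝ → ℝ) (v : ℝ → E)
    (t s : ℝ) : duhamel (fun τ => f (t + τ)) v (s - t) = ∫ τ in t..s, f τ • v (s - τ) := by
  have := intervalIntegral.integral_comp_add_left (a := 0) (b := s - t)
    (fun τ => f τ • v (s - τ)) t
  rw [add_zero, add_sub_cancel] at this
  rw [← this, duhamel]
  congr 1
  ext τ
  congr 2
  ring

section Stochastic

variable {Ω : Type*} {mΩ : MeasurableSpace Ω} {P : Measure Ω} {𝔽 : Filtration ℝ≥0 mΩ} {T : ℝ}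
  {z : ℝ → Ω → ℝ}

lemma IsAdmissible.ae_intervalIntegrable [IsProbabilityMeasure P] (hz : IsAdmissible P 𝔽 T z)
    (hT : 0 ≤ T) : ∀ᵐ ω ∂P, IntervalIntegrable (fun τ => z τ ω) volume 0 T := by
  have h1 : Integrable (fun p : ℝ × Ω => z p.1 p.2) ((volume.restrict (Icc 0 T)).prod P) :=
    hz.memLp.integrable (by norm_num)
  filter_upwards [h1.prod_left_ae] with ω h
  rw [intervalIntegrable_iff_integrableOn_Icc_of_le hT]
  exact h

lemma intervalIntegrable_shift {f : ℝ → ℝ} (hf : IntervalIntegrable f volume 0 T) {t : ℝ}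
    (ht : t ∈ Icc 0 T) : IntervalIntegrable (fun τ => f (t + τ)) volume 0 (T - t) := by
  have h1 : IntervalIntegrable f volume t T := hf.mono_set (by
    rw [uIcc_of_le ht.2, uIcc_of_le (ht.1.trans ht.2)]; exact Icc_subset_Icc_left ht.1)
  have h2 := h1.comp_add_left t
  simpa using h2

variable {E : Type*} [NormedAddCommGroup E] [InnerProductSpace ℝ E] [CompleteSpace E]

/-- Existence of a weak solution, by the mild solution formula. -/
lemma isWeakSolution_mildPath [IsProbabilityMeasure P] {W W' : ℝ≥0 → Ω → ℝ}
    (hc : ∀ ω, Continuous (W' · ω)) (hm : ∀ s, Measurable[𝔽 s] (W' s))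
    (hWW' : ∀ᵐ ω ∂P, ∀ s, W' s ω = W s ω) {Astar : E →ₗ.[ℝ] E} {B x e : E} {G : ℝ →L[ℝ] E}
    (hG : ∀ y, G y = y • e) {u vB vk : ℝ → E} (hu : Continuous u) (hvB : Continuous vB)
    (hvk : Continuous vk) (hu0 : u 0 = x) (hvB0 : vB 0 = B)
    (hu' : ∀ ζ : Astar.domain, ∀ s ∈ Icc 0 T,
      ⟪u s, (ζ : E)⟫_ℝ = ⟪u 0, (ζ : E)⟫_ℝ + ∫ τ in 0..s, ⟪u τ, Astar ζ⟫_ℝ)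
    (hvB' : ∀ ζ : Astar.domain, ∀ s ∈ Icc 0 T,
      ⟪vB s, (ζ : E)⟫_ℝ = ⟪vB 0, (ζ : E)⟫_ℝ + ∫ τ in 0..s, ⟪vB τ, Astar ζ⟫_ℝ)
    (hvk' : ∀ ζ : Astar.domain, ∀ s ∈ Icc 0 T,
      ⟪vk s, (ζ : E)⟫_ℝ = ⟪vk 0, (ζ : E)⟫_ℝ + ∫ τ in 0..s, ⟪vk τ, Astar ζ⟫_ℝ)
    (hk : ∀ ζ : Astar.domain, ⟪vk 0, (ζ : E)⟫_ℝ = ⟪e, Astar ζ⟫_ℝ)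
    (hz : IsAdmissible P 𝔽 T z) {t : ℝ} (ht : t ∈ Icc 0 T) :
    IsWeakSolution P 𝔽 W Astar B G T t x z fun s ω => mildPath u vB vk e (fun τ => z (t + τ) ω)
      (fun τ => W' (t + τ).toNNReal ω - W' t.toNNReal ω) (s - t) := by
  have hT : 0 ≤ T := ht.1.trans ht.2
  have hNc : ∀ ω, Continuous fun τ => W' (t + τ).toNNReal ω - W' t.toNNReal ω := fun ω =>
    ((hc ω).comp (continuous_real_toNNReal.comp (by fun_prop))).sub continuous_const
  refine ⟨fun s hs => ?_, ?_, fun ζ s hs => ?_⟩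
  · have hWs : ∀ τ ≤ s, Measurable[𝔽 s.toNNReal] (W' τ.toNNReal) := fun τ hτ =>
      (hm _).mono (𝔽.mono (Real.toNNReal_le_toNNReal hτ)) le_rfl
    have hs' : s ∈ Icc 0 T := ⟨ht.1.trans hs.1, hs.2⟩
    have h1 : StronglyMeasurable[𝔽 s.toNNReal] fun ω =>
        duhamel (fun τ => z (t + τ) ω) vB (s - t) := by
      simp_rw [fun ω => duhamel_shift (fun τ => z τ ω) vB t s]
      exact @stronglyMeasurable_integral_smul Ω E (𝔽 s.toNNReal) _ _ z 0 t s
        (hz.progressive s hs') _ (by fun_prop) ht.1 hs.1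
    have h2 : StronglyMeasurable[𝔽 s.toNNReal] fun ω =>
        duhamel (fun τ => W' (t + τ).toNNReal ω - W' t.toNNReal ω) vk (s - t) := by
      simp_rw [fun ω => duhamel_shift (fun τ => W' τ.toNNReal ω - W' t.toNNReal ω) vk t s]
      exact @stronglyMeasurable_integral_smul Ω E (𝔽 s.toNNReal) _ _
        (fun τ ω => W' τ.toNNReal ω - W' t.toNNReal ω) 0 t s
        (@Measurable.sub _ _ _ _ _ (_) _ _ (measurable_uncurry_Icc hc hm s)
          (@Measurable.comp _ _ _ (_) (𝔽 s.toNNReal) _ _ _ (hWs t hs.1)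
            (@measurable_snd _ _ _ (𝔽 s.toNNReal)))) _ (by fun_prop) ht.1 hs.1
    have h3 : StronglyMeasurable[𝔽 s.toNNReal] fun ω =>
        (W' (t + (s - t)).toNNReal ω - W' t.toNNReal ω) • e := by
      rw [add_sub_cancel]
      exact (((hWs s le_rfl).stronglyMeasurable).sub
        ((hWs t hs.1).stronglyMeasurable)).smul_const e
    exact ((stronglyMeasurable_const.add h1).add h3).add h2
  · filter_upwards [hz.ae_intervalIntegrable hT] with ω hω
    refine (continuousOn_mildPath hu hvB hvk e (hNc ω) (sub_nonneg.2 ht.2)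
      (intervalIntegrable_shift hω ht)).comp (by fun_prop) fun s hs => ?_
    exact ⟨sub_nonneg.2 hs.1, sub_le_sub_right hs.2 t⟩
  · have hsub : ∀ s ∈ Icc 0 (T - t), s ∈ Icc 0 T := fun s hs => ⟨hs.1, by linarith [hs.2, ht.1]⟩
    filter_upwards [hz.ae_intervalIntegrable hT, hWW'] with ω hω hωW
    have h1 := inner_mildPath hu hvB hvk (e := e) (hNc ω) (intervalIntegrable_shift hω ht)
      (fun s hs => hu' ζ s (hsub s hs)) (fun s hs => hvB' ζ s (hsub s hs))
      (fun s hs => hvk' ζ s (hsub s hs)) (hk ζ)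
      (⟨sub_nonneg.2 hs.1, sub_le_sub_right hs.2 t⟩ : s - t ∈ Icc 0 (T - t))
    have h2 := intervalIntegral.integral_comp_add_left (a := 0) (b := s - t)
      (fun τ => ⟪mildPath u vB vk e (fun τ => z (t + τ) ω)
        (fun τ => W' (t + τ).toNNReal ω - W' t.toNNReal ω) (τ - t), Astar ζ⟫_ℝ
        + ⟪z τ ω • B, (ζ : E)⟫_ℝ) t
    simp only [add_zero, add_sub_cancel, add_sub_cancel_left] at h2
    rw [h1, ← h2, hu0, hvB0, hG, inner_smul_left, conj_trivial, add_sub_cancel, hωW, hωW]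

/-- Pathwise uniqueness of weak solutions. The weak equations are imposed up to null events which
depend on the time and on the test vector, and both are reduced to countable dense sets. -/
lemma IsWeakSolution.ae_eq [SecondCountableTopology E] {W : ℝ≥0 → Ω → ℝ} {Astar : E →ₗ.[ℝ] E}
    {B x : E} {G : ℝ →L[ℝ] E} {t C : ℝ} {Y Y' : ℝ → Ω → E}
    (hdiss : ∀ m d : E, (∀ p ∈ Astar.graph, ⟪d, p.1⟫_ℝ = ⟪m, p.2⟫_ℝ) → ⟪d, m⟫_ℝ ≤ C * ‖m‖ ^ 2)
    (hsep : ∀ d : E, (∀ p ∈ Astar.graph, ⟪d, p.1⟫_ℝ = 0) → d = 0)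
    (hz : ∀ᵐ ω ∂P, IntervalIntegrable (fun τ => z τ ω) volume 0 T) (ht : t ∈ Icc 0 T)
    (hY : IsWeakSolution P 𝔽 W Astar B G T t x z Y)
    (hY' : IsWeakSolution P 𝔽 W Astar B G T t x z Y') :
    ∀ᵐ ω ∂P, ∀ s ∈ Icc t T, Y' s ω = Y s ω := by
  have : Nonempty (Icc t T) := ⟨⟨t, left_mem_Icc.2 ht.2⟩⟩
  have : Nonempty Astar.graph := ⟨0⟩
  set ζ : ℕ → Astar.graph := TopologicalSpace.denseSeq Astar.graph
  set θ : ℕ → Icc t T := TopologicalSpace.denseSeq (Icc t T)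
  have hpt : ∀ i j, ∀ᵐ ω ∂P, ContinuousOn (fun s => Y s ω) (Icc t T) →
      ContinuousOn (fun s => Y' s ω) (Icc t T) →
      IntervalIntegrable (fun τ => z τ ω) volume 0 T →
      ⟪Y' (θ j) ω - Y (θ j) ω, (ζ i : E × E).1⟫_ℝ
        = ⟪∫ τ in t..(θ j), (Y' τ ω - Y τ ω), (ζ i : E × E).2⟫_ℝ := by
    intro i j
    obtain ⟨y, hy⟩ := (LinearPMap.mem_graph_iff' Astar).1 (ζ i).2
    filter_upwards [hY.eq y (θ j) (θ j).2, hY'.eq y (θ j) (θ j).2] with ω h1 h2 hc hc' hzi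
    rw [← hy]
    dsimp only
    have hsub : uIcc t (θ j) ⊆ Icc t T := by
      rw [uIcc_of_le (θ j).2.1]; exact Icc_subset_Icc_right (θ j).2.2
    have hi1 : IntervalIntegrable (fun τ => Y τ ω) volume t (θ j) :=
      (hc.mono hsub).intervalIntegrable
    have hi2 : IntervalIntegrable (fun τ => Y' τ ω) volume t (θ j) :=
      (hc'.mono hsub).intervalIntegrable
    have hi3 : IntervalIntegrable (fun τ => ⟪z τ ω • B, (y : E)⟫_ℝ) volume t (θ j) := by
      simp only [inner_smul_left, conj_trivial]
      refine (hzi.mono_set ?_).mul_const _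
      rw [uIcc_of_le (ht.1.trans ht.2)]
      exact hsub.trans (Icc_subset_Icc_left ht.1)
    have hj1 : IntervalIntegrable (fun τ => ⟪Y τ ω, Astar y⟫_ℝ) volume t (θ j) :=
      ((hc.mono hsub).inner continuousOn_const).intervalIntegrable
    have hj2 : IntervalIntegrable (fun τ => ⟪Y' τ ω, Astar y⟫_ℝ) volume t (θ j) :=
      ((hc'.mono hsub).inner continuousOn_const).intervalIntegrable
    rw [intervalIntegral.integral_add hj1 hi3] at h1
    rw [intervalIntegral.integral_add hj2 hi3] at h2
    rw [intervalIntegral.integral_sub hi2 hi1, inner_sub_left, inner_sub_left, h1, h2,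
      integral_inner_left hi1, integral_inner_left hi2]
    ring
  filter_upwards [ae_all_iff.2 fun i => ae_all_iff.2 (hpt i), hY.continuousOn, hY'.continuousOn, hz]
    with ω h hc hc' hzi
  set D : ℝ → E := fun s => Y' s ω - Y s ω
  have hD : ContinuousOn D (Icc t T) := hc'.sub hc
  have hI : ContinuousOn (fun s => ∫ τ in t..s, D τ) (Icc t T) := by
    have := intervalIntegral.continuousOn_primitive_interval' (f := D) (μ := volume)
      (a := t) (b₁ := t) (b₂ := T) (ContinuousOn.intervalIntegrable (by rwa [uIcc_of_le ht.2]))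
      left_mem_uIcc
    rwa [uIcc_of_le ht.2] at this
  have hdense : DenseRange (Prod.map ζ θ) :=
    (TopologicalSpace.denseRange_denseSeq _).prodMap (TopologicalSpace.denseRange_denseSeq _)
  have heq : (fun q : Astar.graph × Icc t T => ⟪D q.2, (q.1 : E × E).1⟫_ℝ)
      = fun q => ⟪∫ τ in t..(q.2 : ℝ), D τ, (q.1 : E × E).2⟫_ℝ := by
    refine hdense.equalizer ?_ ?_ ?_
    · exact ((continuousOn_iff_continuous_domRestrict.1 hD).comp continuous_snd).inner
        (continuous_fst.comp (continuous_subtype_val.comp continuous_fst))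
    · exact ((continuousOn_iff_continuous_domRestrict.1 hI).comp continuous_snd).inner
        (continuous_snd.comp (continuous_subtype_val.comp continuous_fst))
    · ext ⟨i, j⟩
      exact h i j hc hc' hzi
  have key := eq_zero_of_weak_homogeneous (Γ := (Astar.graph : Set (E × E))) ht.2 hD
    (fun p hp s hs => ?_) hdiss hsep
  · exact fun s hs => sub_eq_zero.1 (key s hs)
  · rw [integral_inner_left]
    · exact congrFun heq (⟨p, hp⟩, ⟨s, hs⟩)
    · refine ContinuousOn.intervalIntegrable (hD.mono ?_)
      rw [uIcc_of_le hs.1]; exact Icc_subset_Icc_right hs.2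

end Stochastic

/-! ### The expected payoff -/

/-- The terminal state tested against `w(T)`, when `w` is dual to the homogeneous evolutions. -/
lemma inner_mildPath_terminal {E : Type*} [NormedAddCommGroup E] [InnerProductSpace ℝ E]
    [CompleteSpace E] {u vB vk w : ℝ → E} {x B k wT : E} (hvB : Continuous vB)
    (hvk : Continuous vk) (e : E) {z n : ℝ → ℝ} (hn : Continuous n) {t T : ℝ} (ht : t ∈ Icc 0 T)
    (hz : IntervalIntegrable z volume 0 T)
    (hu' : ∀ s ∈ Icc 0 T, ⟪u s, wT⟫_ℝ = ⟪w (T - s), x⟫_ℝ)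
    (hvB' : ∀ s ∈ Icc 0 T, ⟪vB s, wT⟫_ℝ = ⟪w (T - s), B⟫_ℝ)
    (hvk' : ∀ s ∈ Icc 0 T, ⟪vk s, wT⟫_ℝ = ⟪w (T - s), k⟫_ℝ) :
    ⟪mildPath u vB vk e (fun τ => z (t + τ)) (fun τ => n (t + τ)) (T - t), wT⟫_ℝ
      = ⟪w t, x⟫_ℝ + (∫ τ in t..T, z τ * ⟪w τ, B⟫_ℝ) + n T * ⟪e, wT⟫_ℝ
        + ∫ τ in t..T, n τ * ⟪w τ, k⟫_ℝ := by
  have hd : ∀ {v : ℝ → E} {y : E} {f : ℝ → ℝ}, Continuous v →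
      (∀ s ∈ Icc 0 T, ⟪v s, wT⟫_ℝ = ⟪w (T - s), y⟫_ℝ) → IntervalIntegrable f volume 0 T →
      ⟪duhamel (fun τ => f (t + τ)) v (T - t), wT⟫_ℝ = ∫ τ in t..T, f τ * ⟪w τ, y⟫_ℝ := by
    intro v y f hv hv' hf
    have hft : IntervalIntegrable f volume t T := hf.mono_set (by
      rw [uIcc_of_le ht.2, uIcc_of_le (ht.1.trans ht.2)]; exact Icc_subset_Icc_left ht.1)
    rw [duhamel_shift, ← integral_inner_left (hft.smul_continuousOn (by fun_prop))]
    refine intervalIntegral.integral_congr fun τ hτ => ?_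
    rw [uIcc_of_le ht.2] at hτ
    rw [inner_smul_left, conj_trivial, hv' (T - τ) ⟨by linarith [hτ.2], by linarith [hτ.1, ht.1]⟩,
      sub_sub_cancel]
  rw [mildPath, inner_add_left, inner_add_left, inner_add_left, hd hvB hvB' hz,
    hd hvk hvk' (hn.intervalIntegrable _ _), hu' (T - t) ⟨by linarith [ht.2], by linarith [ht.1]⟩,
    sub_sub_cancel, add_sub_cancel, inner_smul_left, conj_trivial]

section Expectation

variable {Ω : Type*} {mΩ : MeasurableSpace Ω} {P : Measure Ω}

lemma integral_norm_brownian_le [IsProbabilityMeasure P] {W : ℝ≥0 → Ω → ℝ}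
    (hW : IsPreBrownianReal W P) (s : ℝ≥0) : ∫ ω, ‖W s ω‖ ∂P ≤ 1 + s := by
  have h2 : MemLp (W s) 2 P := (hW.isGaussianProcess.hasGaussianLaw_eval s).memLp_two
  have h3 : ∫ ω, W s ω ^ 2 ∂P = s := by
    rw [← variance_of_integral_eq_zero (hW.aemeasurable s) (hW.integral_eval s), ← covariance_self
      (hW.aemeasurable s), hW.covariance_eval, min_self]
  calc ∫ ω, ‖W s ω‖ ∂P ≤ ∫ ω, (1 + W s ω ^ 2) ∂P := by
        refine integral_mono (hW.integrable_eval s).norm ((integrable_const _).add h2.integrable_sq)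
          fun ω => ?_
        dsimp only
        rw [Real.norm_eq_abs, ← sq_abs]
        nlinarith [sq_nonneg (|W s ω| - 1), abs_nonneg (W s ω)]
    _ = 1 + s := by
        rw [integral_add (integrable_const _) h2.integrable_sq, h3]
        simp

/-- A time integral of increments of Brownian motion is integrable with mean zero. -/
lemma integrable_integral_brownian [IsProbabilityMeasure P] {W : ℝ≥0 → Ω → ℝ}
    (hc : ∀ ω, Continuous (W · ω)) (hm : ∀ s, Measurable (W s)) (hW : IsPreBrownianReal W P)
    {m : ℝ → ℝ} (hmc : Continuous m) {t T : ℝ} (ht : t ∈ Icc 0 T) :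
    Integrable (fun ω => ∫ τ in t..T, (W τ.toNNReal ω - W t.toNNReal ω) * m τ) P ∧
      ∫ ω, (∫ τ in t..T, (W τ.toNNReal ω - W t.toNNReal ω) * m τ) ∂P = 0 := by
  obtain ⟨C, hC⟩ := (isCompact_Icc (a := t) (b := T)).exists_bound_of_continuousOn hmc.continuousOn
  have hC0 : 0 ≤ C := (norm_nonneg _).trans (hC t (left_mem_Icc.2 ht.2))
  have hmeas : Measurable fun q : ℝ × Ω => (W q.1.toNNReal q.2 - W t.toNNReal q.2) * m q.1 := by
    have h1 : Measurable fun q : ℝ × Ω => W q.1.toNNReal q.2 :=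
      measurable_uncurry_of_continuous_of_measurable (u := fun (τ : ℝ) ω => W τ.toNNReal ω)
        (fun ω => (hc ω).comp continuous_real_toNNReal) fun τ => hm _
    exact (h1.sub ((hm _).comp measurable_snd)).mul (hmc.measurable.comp measurable_fst)
  have hi : ∀ τ : ℝ, Integrable (fun ω => (W τ.toNNReal ω - W t.toNNReal ω) * m τ) P := fun τ =>
    ((hW.integrable_eval _).sub (hW.integrable_eval _)).mul_const _
  have hint : Integrable (fun q : ℝ × Ω => (W q.1.toNNReal q.2 - W t.toNNReal q.2) * m q.1)
      ((volume.restrict (Ioc t T)).prod P) := by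
    rw [integrable_prod_iff hmeas.aestronglyMeasurable]
    refine ⟨ae_of_all _ hi, ?_⟩
    refine (integrable_const (((1 + T) + (1 + T)) * C)).mono'
      (hmeas.aestronglyMeasurable.norm.integral_prod_right') ?_
    refine (ae_restrict_iff' measurableSet_Ioc).2 (ae_of_all _ fun τ hτ => ?_)
    have hτ' := hC τ (Ioc_subset_Icc_self hτ)
    have hle : ∀ s ∈ Icc 0 T, ∫ ω, ‖W s.toNNReal ω‖ ∂P ≤ 1 + T := fun s hs => by
      refine (integral_norm_brownian_le hW _).trans ?_
      rw [Real.coe_toNNReal _ hs.1]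
      linarith [hs.2]
    rw [Real.norm_of_nonneg (integral_nonneg fun ω => norm_nonneg _)]
    simp_rw [norm_mul]
    rw [integral_mul_const]
    refine mul_le_mul ?_ hτ' (norm_nonneg _) (by linarith [ht.1, ht.2])
    refine le_trans (integral_mono ((hW.integrable_eval _).sub (hW.integrable_eval _)).norm
      ((hW.integrable_eval _).norm.add (hW.integrable_eval _).norm) fun ω => norm_sub_le _ _) ?_
    rw [integral_add' (hW.integrable_eval _).norm (hW.integrable_eval _).norm]
    exact add_le_add (hle τ ⟨ht.1.trans hτ.1.le, hτ.2⟩) (hle t ht)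
  simp_rw [intervalIntegral.integral_of_le ht.2]
  refine ⟨hint.integral_prod_right, ?_⟩
  rw [← integral_integral_swap (f := fun τ ω => (W τ.toNNReal ω - W t.toNNReal ω) * m τ) hint]
  have : ∀ τ : ℝ, ∫ ω, (W τ.toNNReal ω - W t.toNNReal ω) * m τ ∂P = 0 := fun τ => by
    rw [integral_mul_const, integral_sub (hW.integrable_eval _) (hW.integrable_eval _),
      hW.integral_eval, hW.integral_eval, sub_self, zero_mul]
  simp_rw [this]
  simp

variable {𝔽 : Filtration ℝ≥0 mΩ} {T : ℝ} {z : ℝ → Ω → ℝ}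

/-- The total reward `∫_t^T (z b - β z²)` of a control against the shadow price `b`. -/
def reducedPayoff (β : ℝ) (b : ℝ → ℝ) (z : ℝ → Ω → ℝ) (t T : ℝ) (ω : Ω) : ℝ :=
  ∫ τ in t..T, (z τ ω * b τ - β * z τ ω ^ 2)

lemma IsAdmissible.ae_intervalIntegrable_sq (hz : IsAdmissible P 𝔽 T z)
    [IsProbabilityMeasure P] {t : ℝ} (ht : t ∈ Icc 0 T) :
    ∀ᵐ ω ∂P, IntervalIntegrable (fun τ => z τ ω ^ 2) volume t T := by
  filter_upwards [hz.memLp.integrable_sq.prod_left_ae] with ω h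
  rw [intervalIntegrable_iff_integrableOn_Icc_of_le ht.2]
  exact IntegrableOn.mono_set (t := Icc 0 T) h (Icc_subset_Icc_left ht.1)

lemma IsAdmissible.integrable_reducedPayoff (hz : IsAdmissible P 𝔽 T z) [IsProbabilityMeasure P]
    (β : ℝ) {b : ℝ → ℝ} (hb : Continuous b) {t : ℝ} (ht : t ∈ Icc 0 T) :
    Integrable (reducedPayoff β b z t T) P := by
  obtain ⟨C, hC⟩ := (isCompact_Icc (a := 0) (b := T)).exists_bound_of_continuousOn hb.continuousOn
  have h1 : Integrable (fun q : ℝ × Ω => z q.1 q.2) ((volume.restrict (Icc 0 T)).prod P) :=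
    hz.memLp.integrable (by norm_num)
  have hae : ∀ᵐ q ∂((volume.restrict (Icc 0 T)).prod P), q.1 ∈ Icc 0 T :=
    Measure.quasiMeasurePreserving_fst.ae (ae_restrict_mem measurableSet_Icc)
  have h2 : Integrable (fun q : ℝ × Ω => z q.1 q.2 * b q.1 - β * z q.1 q.2 ^ 2)
      ((volume.restrict (Icc 0 T)).prod P) := by
    refine (h1.mul_bdd (c := C) ?_ ?_).sub (hz.memLp.integrable_sq.const_mul β)
    · exact (hb.measurable.comp measurable_fst).aestronglyMeasurable
    · filter_upwards [hae] with q hq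
      exact hC _ hq
  have h3 : Integrable (fun q : ℝ × Ω => z q.1 q.2 * b q.1 - β * z q.1 q.2 ^ 2)
      ((volume.restrict (Ioc t T)).prod P) :=
    h2.mono_measure (Measure.prod_mono (Measure.restrict_mono
      (Ioc_subset_Icc_self.trans (Icc_subset_Icc_left ht.1)) le_rfl) le_rfl)
  refine h3.integral_prod_right.congr (ae_of_all _ fun ω => ?_)
  rw [reducedPayoff, intervalIntegral.integral_of_le ht.2]

/-- Pointwise maximization of the running reward bounds the expected reward of any control. -/
lemma IsAdmissible.integral_reducedPayoff_le (hz : IsAdmissible P 𝔽 T z) [IsProbabilityMeasure P]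
    {β : ℝ} (hβ : 0 < β) {b : ℝ → ℝ} (hb : Continuous b) {t : ℝ} (ht : t ∈ Icc 0 T) :
    ∫ ω, reducedPayoff β b z t T ω ∂P ≤ ∫ τ in t..T, (max (b τ) 0) ^ 2 / (4 * β) := by
  have key : ∀ᵐ ω ∂P, reducedPayoff β b z t T ω ≤ ∫ τ in t..T, (max (b τ) 0) ^ 2 / (4 * β) := by
    filter_upwards [hz.ae_intervalIntegrable (ht.1.trans ht.2), hz.ae_intervalIntegrable_sq ht]
      with ω h1 h2
    have h3 : IntervalIntegrable (fun τ => z τ ω) volume t T := h1.mono_set (by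
      rw [uIcc_of_le ht.2, uIcc_of_le (ht.1.trans ht.2)]; exact Icc_subset_Icc_left ht.1)
    refine intervalIntegral.integral_mono_on ht.2
      ((h3.mul_continuousOn hb.continuousOn).sub (h2.const_mul β))
      (Continuous.intervalIntegrable (by fun_prop) _ _) fun τ hτ => ?_
    exact mul_sub_sq_le hβ (hz.nonneg τ ⟨ht.1.trans hτ.1, hτ.2⟩ ω) (b τ)
  calc ∫ ω, reducedPayoff β b z t T ω ∂P
      ≤ ∫ _, (∫ τ in t..T, (max (b τ) 0) ^ 2 / (4 * β)) ∂P :=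
        integral_mono_ae (hz.integrable_reducedPayoff β hb ht) (integrable_const _) key
    _ = _ := by simp

lemma reducedPayoff_maximizer {β : ℝ} (hβ : 0 < β) (b : ℝ → ℝ) (t : ℝ) (ω : Ω) :
    reducedPayoff β b (fun s _ => max (b s) 0 / (2 * β)) t T ω
      = ∫ τ in t..T, (max (b τ) 0) ^ 2 / (4 * β) := by
  rw [reducedPayoff]
  simp_rw [mul_sub_sq_maximizer hβ]

lemma isAdmissible_of_continuous [IsProbabilityMeasure P] {f : ℝ → ℝ} (hf : Continuous f)
    (h0 : ∀ s, 0 ≤ f s) : IsAdmissible P 𝔽 T (fun s _ => f s) := by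
  refine ⟨fun s _ => ?_, fun s _ _ => h0 s, ?_⟩
  · have h1 : Measurable fun τ : Icc (0 : ℝ) s => f τ :=
      hf.measurable.comp measurable_subtype_coe
    let _ : MeasurableSpace Ω := 𝔽 s.toNNReal
    exact h1.comp measurable_fst
  · obtain ⟨C, hC⟩ := (isCompact_Icc (a := 0) (b := T)).exists_bound_of_continuousOn hf.continuousOn
    have hae : ∀ᵐ q ∂((volume.restrict (Icc 0 T)).prod P), q.1 ∈ Icc 0 T :=
      Measure.quasiMeasurePreserving_fst.ae (ae_restrict_mem measurableSet_Icc)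
    refine (memLp_top_of_bound (C := C)
      (hf.measurable.comp measurable_fst).aestronglyMeasurable ?_).mono_exponent le_top
    filter_upwards [hae] with q hq
    exact hC _ hq

/-- When weak solutions are unique, the objective can be computed along any weak solution. -/
lemma J_eq_integral_payoff {E : Type*} [NormedAddCommGroup E] [InnerProductSpace ℝ E]
    {W : ℝ≥0 → Ω → ℝ} {Astar : E →ₗ.[ℝ] E} {B x : E} {G : ℝ →L[ℝ] E} {φ : E → ℝ} {h : ℝ → ℝ}
    {t : ℝ} (ht : t ∈ Icc 0 T) {Y : ℝ → Ω → E}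
    (hY : IsWeakSolution P 𝔽 W Astar B G T t x z Y)
    (huniq : ∀ Y', IsWeakSolution P 𝔽 W Astar B G T t x z Y' →
      ∀ᵐ ω ∂P, ∀ s ∈ Icc t T, Y' s ω = Y s ω) :
    J P 𝔽 W Astar B G φ h T t x z = ∫ ω, payoff φ h T t z Y ω ∂P := by
  have hex : ∃ Y, IsWeakSolution P 𝔽 W Astar B G T t x z Y := ⟨Y, hY⟩
  rw [J, dif_pos hex]
  refine integral_congr_ae ?_
  filter_upwards [huniq _ hex.choose_spec] with ω hω
  rw [payoff, payoff, hω T (right_mem_Icc.2 ht.2)]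

end Expectation

/-! ### The delay control problem -/

instance (r : ℝ) : SecondCountableTopology (X r) := by
  have h2 : Fact ((2 : ℝ≥0∞) ≠ ∞) := ⟨by norm_num⟩
  have : SecondCountableTopology (L2 r) := inferInstance
  infer_instance

section DelayProblem

variable {r a₀ T : ℝ} {a₁ : L2 r} {p : ℝ → ℝ}

/-- The duality between the forward flow and the backward path `w`. -/
lemma inner_delayFlow_terminal (hp : IsFundamental a₀ a₁ T p) (γ : ℝ) (x : X r) {s : ℝ}
    (hs : s ∈ Icc 0 T) :
    ⟪delayFlow a₀ a₁ T hp.continuous x s, (WithLp.toLp 2 (γ, 0) : X r)⟫_ℝ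
      = ⟪adjointFlow r T γ hp.continuous (T - s), x⟫_ℝ := by
  rw [X.inner_eq, adjointFlow, inner_smul_left, sub_sub_cancel, ← fst_delayFlow hp x hs]
  simp [mul_comm]

variable {Ω : Type*} {mΩ : MeasurableSpace Ω} {P : Measure Ω} [IsProbabilityMeasure P]
  {𝔽 : Filtration ℝ≥0 mΩ} {z : ℝ → Ω → ℝ}

lemma ae_eq_of_isWeakSolution (hr : 0 < r) {W : ℝ≥0 → Ω → ℝ} {B x : X r} {G : ℝ →L[ℝ] X r}
    {t : ℝ} (ht : t ∈ Icc 0 T) (hz : IsAdmissible P 𝔽 T z) {Y Y' : ℝ → Ω → X r}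
    (hY : IsWeakSolution P 𝔽 W (opAstar r a₀ a₁) B G T t x z Y)
    (hY' : IsWeakSolution P 𝔽 W (opAstar r a₀ a₁) B G T t x z Y') :
    ∀ᵐ ω ∂P, ∀ s ∈ Icc t T, Y' s ω = Y s ω := by
  refine IsWeakSolution.ae_eq (C := |a₀| + 1 / 2 + ‖a₁‖) ?_ ?_
    (hz.ae_intervalIntegrable (ht.1.trans ht.2)) ht hY hY'
  · rw [opAstar_graph hr]
    exact fun m d h => inner_le_of_mem_graphA hr.le (mem_graphA_of_inner_eq hr.le h)
  · rw [opAstar_graph hr]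
    exact fun d h => eq_zero_of_inner_graphAstar hr h

/-- Well-posedness of the state equation, and the expected payoff: up to the term `⟨w(t), x⟩` the
control enters only through the running reward against the shadow price `⟨w, B⟩`. -/
theorem exists_isWeakSolution (hr : 0 < r) (hp : IsFundamental a₀ a₁ T p) {W : ℝ≥0 → Ω → ℝ}
    (hWm : ∀ s, Measurable (W s)) (hW : IsBrownianReal W P) (σ β γ : ℝ) (B x : X r) {t : ℝ}
    (ht : t ∈ Icc 0 T) (hz : IsAdmissible P (brownianFiltration P W hWm) T z) :
    ∃ Y, IsWeakSolution P (brownianFiltration P W hWm) W (opAstar r a₀ a₁) B (opG r σ) T t x z Y ∧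
      Integrable (payoff (fun x : X r => γ * x.fst) (fun z => -β * z ^ 2) T t z Y) P ∧
      ∫ ω, payoff (fun x : X r => γ * x.fst) (fun z => -β * z ^ 2) T t z Y ω ∂P
        = ⟪adjointFlow r T γ hp.continuous t, x⟫_ℝ
          + ∫ ω, reducedPayoff β (fun τ => ⟪B, adjointFlow r T γ hp.continuous τ⟫_ℝ) z t T ω ∂P := by
  have hT : 0 ≤ T := ht.1.trans ht.2
  have hc := hp.continuous
  obtain ⟨W', hW'c, hW'm, hWW'⟩ := exists_continuous_modification hWm hW.cont
  have hW'B : IsPreBrownianReal W' P := hW.toIsPreBrownianReal.congr fun s => by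
    filter_upwards [hWW'] with ω hω using (hω s).symm
  set e : X r := WithLp.toLp 2 (σ, 0) with he
  set k : X r := WithLp.toLp 2 (σ * a₀, σ • a₁) with hk
  set w := adjointFlow r T γ hc with hw
  have hwc : Continuous w := continuous_adjointFlow γ hc
  set U := delayFlow a₀ a₁ T hc with hU
  have hUc : ∀ y, Continuous (U y) := continuous_delayFlow hc
  have hUeq : ∀ y, ∀ ζ : (opAstar r a₀ a₁).domain, ∀ s ∈ Icc 0 T, ⟪U y s, (ζ : X r)⟫_ℝ
      = ⟪U y 0, (ζ : X r)⟫_ℝ + ∫ τ in 0..s, ⟪U y τ, opAstar r a₀ a₁ ζ⟫_ℝ := fun y ζ s hs => by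
    have hζ : ((ζ : X r), opAstar r a₀ a₁ ζ) ∈ graphAstar r a₀ a₁ := by
      rw [← opAstar_graph hr]
      exact LinearPMap.mem_graph _ ζ
    rw [hU, delayFlow_zero, inner_delayFlow hr hp y hζ hs]
  have hkζ : ∀ ζ : (opAstar r a₀ a₁).domain, ⟪U k 0, (ζ : X r)⟫_ℝ = ⟪e, opAstar r a₀ a₁ ζ⟫_ℝ :=
    fun ζ => by
      have hζ : ((ζ : X r), opAstar r a₀ a₁ ζ) ∈ graphAstar r a₀ a₁ := by
        rw [← opAstar_graph hr]
        exact LinearPMap.mem_graph _ ζ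
      obtain ⟨F, -, -, h3⟩ := hζ
      change (opAstar r a₀ a₁ ζ).fst = a₀ * (ζ : X r).fst + ⟪a₁, (ζ : X r).snd⟫_ℝ at h3
      rw [hU, delayFlow_zero, X.inner_eq, X.inner_eq, hk, he]
      simp only [WithLp.toLp_fst, WithLp.toLp_snd, inner_zero_left, inner_smul_left, conj_trivial]
      rw [h3]
      ring
  have hG : ∀ y, opG r σ y = y • e := fun y => rfl
  refine ⟨_, isWeakSolution_mildPath hW'c hW'm hWW' hG (hUc x) (hUc B) (hUc k)
    (delayFlow_zero hc x) (delayFlow_zero hc B) (hUeq x) (hUeq B) (hUeq k) hkζ hz ht, ?_⟩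
  set Y := fun s ω => mildPath (U x) (U B) (U k) e (fun τ => z (t + τ) ω)
      (fun τ => W' (t + τ).toNNReal ω - W' t.toNNReal ω) (s - t) with hY
  -- the noise enters the payoff through centred terms only
  set M : Ω → ℝ := fun ω => (W' T.toNNReal ω - W' t.toNNReal ω) * ⟪e, WithLp.toLp 2 (γ, 0)⟫_ℝ
    + ∫ τ in t..T, (W' τ.toNNReal ω - W' t.toNNReal ω) * ⟪w τ, k⟫_ℝ with hM
  have hM1 : Integrable (fun ω => (W' T.toNNReal ω - W' t.toNNReal ω)
      * ⟪e, WithLp.toLp 2 (γ, 0)⟫_ℝ) P :=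
    ((hW'B.integrable_eval _).sub (hW'B.integrable_eval _)).mul_const _
  obtain ⟨hM2, hM3⟩ := integrable_integral_brownian hW'c
    (fun s => (hW'm s).mono ((brownianFiltration P W hWm).le s) le_rfl) hW'B
    (m := fun τ => ⟪w τ, k⟫_ℝ) (by fun_prop) ht
  have hMi : Integrable M P := hM1.add hM2
  have hM0 : ∫ ω, M ω ∂P = 0 := by
    rw [hM, integral_add hM1 hM2, hM3, integral_mul_const, integral_sub (hW'B.integrable_eval _)
      (hW'B.integrable_eval _), hW'B.integral_eval, hW'B.integral_eval]
    ring
  set b : ℝ → ℝ := fun τ => ⟪B, w τ⟫_ℝ with hb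
  have hbc : Continuous b := by fun_prop
  have hR := hz.integrable_reducedPayoff β hbc ht
  have hpay : payoff (fun x : X r => γ * x.fst) (fun z => -β * z ^ 2) T t z Y
      =ᵐ[P] fun ω => (⟪w t, x⟫_ℝ + M ω) + reducedPayoff β b z t T ω := by
    filter_upwards [hz.ae_intervalIntegrable hT, hz.ae_intervalIntegrable_sq ht] with ω h1 h2
    have h3 : IntervalIntegrable (fun τ => z τ ω) volume t T := h1.mono_set (by
      rw [uIcc_of_le ht.2, uIcc_of_le hT]; exact Icc_subset_Icc_left ht.1)
    have hn : Continuous fun τ : ℝ => W' τ.toNNReal ω - W' t.toNNReal ω :=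
      ((hW'c ω).comp continuous_real_toNNReal).sub continuous_const
    have h4 := inner_mildPath_terminal (hUc B) (hUc k) e hn ht h1
      (fun s hs => inner_delayFlow_terminal hp γ x hs)
      (fun s hs => inner_delayFlow_terminal hp γ B hs)
      (fun s hs => inner_delayFlow_terminal hp γ k hs)
    have h5 : ∀ y : X r, γ * y.fst = ⟪y, (WithLp.toLp 2 (γ, 0) : X r)⟫_ℝ := fun y => by
      rw [X.inner_eq]
      simp [mul_comm]
    have h6 : reducedPayoff β b z t T ω = (∫ τ in t..T, z τ ω * ⟪w τ, B⟫_ℝ)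
        + ∫ τ in t..T, -β * z τ ω ^ 2 := by
      rw [reducedPayoff, ← intervalIntegral.integral_add]
      · refine intervalIntegral.integral_congr fun τ _ => ?_
        simp only [hb, real_inner_comm (w τ) B]
        ring
      · exact h3.mul_continuousOn (by fun_prop)
      · exact h2.const_mul _
    rw [payoff, h5, h6, hY, hM]
    dsimp only
    rw [h4]
    ring
  have hi : Integrable (fun ω => ⟪w t, x⟫_ℝ + M ω) P := (integrable_const _).add hMi
  refine ⟨(hi.add hR).congr hpay.symm, ?_⟩
  rw [integral_congr_ae hpay, integral_add hi hR, integral_add (integrable_const _) hMi, hM0]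
  simp

end DelayProblem

end DelayControl

end

theorem mainTheorem4 {Ω : Type*} {mΩ : MeasurableSpace Ω} (P : Measure Ω) [IsProbabilityMeasure P]
    (W : ℝ≥0 → Ω → ℝ) (hWm : ∀ s, Measurable (W s)) (hW : IsBrownianReal W P)
    (r T a₀ b₀ σ β γ : ℝ) (hr : 0 < r) (hT : 0 < T) (ha₀ : a₀ ≤ 0) (hb₀ : 0 ≤ b₀)
    (hβ : 0 < β) (hγ : 0 < γ) (a₁ b₁ : DelayControl.L2 r)
    (hb₁ : ∀ᵐ ξ ∂(volume.restrict (Icc (-r) 0)), 0 ≤ b₁ ξ)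
    (𝔽 : Filtration ℝ≥0 mΩ) (h𝔽 : 𝔽 = DelayControl.brownianFiltration P W hWm)
    (A Astar : DelayControl.X r →ₗ.[ℝ] DelayControl.X r)
    (hA : A = DelayControl.opA r a₀ a₁) (hAstar : Astar = DelayControl.opAstar r a₀ a₁)
    (B : DelayControl.X r) (hB : B = WithLp.toLp 2 (b₀, b₁))
    (G : ℝ →L[ℝ] DelayControl.X r) (hG : G = DelayControl.opG r σ)
    (h : ℝ → ℝ) (hh : h = fun z => -β * z ^ 2)
    (φ : DelayControl.X r → ℝ) (hφ : φ = fun x => γ * x.fst) :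
    -- the Hamiltonian and its maximizer
    (∀ p : DelayControl.X r,
      DelayControl.hamiltonian B h p = (max ⟪B, p⟫_ℝ 0) ^ 2 / (4 * β) ∧
      IsGreatest (DelayControl.hamiltonianValues B h p)
        (⟪(max ⟪B, p⟫_ℝ 0 / (2 * β)) • B, p⟫_ℝ + h (max ⟪B, p⟫_ℝ 0 / (2 * β)))) ∧
    -- the state equation is well posed and the objective is well defined
    (∀ t ∈ Icc 0 T, ∀ x : DelayControl.X r, ∀ z, DelayControl.IsAdmissible P 𝔽 T z →
      ∃ Y, DelayControl.IsWeakSolution P 𝔽 W Astar B G T t x z Y ∧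
        Integrable (DelayControl.payoff φ h T t z Y) P ∧
        ∀ Y', DelayControl.IsWeakSolution P 𝔽 W Astar B G T t x z Y' →
          ∀ᵐ ω ∂P, ∀ s ∈ Icc t T, Y' s ω = Y s ω) ∧
    ∃ w : ℝ → DelayControl.X r, ∃ c : ℝ → ℝ,
      -- `w` is the solution of `w' + A* w = 0`, `w(T) = (γ, 0)`
      DelayControl.IsAdjointSolution A T (WithLp.toLp 2 (γ, 0)) w ∧
      (∀ w', DelayControl.IsAdjointSolution A T (WithLp.toLp 2 (γ, 0)) w' →
        EqOn w' w (Icc 0 T)) ∧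
      (∀ t ∈ Icc 0 T, HasDerivWithinAt (fun s => (w s).fst)
        (-(a₀ * (w t).fst + ∫ ξ in (-r)..0, a₁ ξ * (w t).snd ξ)) (Icc 0 T) t) ∧
      (∀ t ∈ Icc 0 T, ∀ᵐ ξ ∂(volume.restrict (Icc (-r) 0)),
        (w t).snd ξ = (Icc 0 T).indicator (fun s => (w s).fst) (t - ξ)) ∧
      -- `c` is the solution of `c' + (⟨B, w⟩⁺)² / (4β) = 0`, `c(T) = 0`
      (∀ t ∈ Icc 0 T,
        HasDerivWithinAt c (-((max ⟪B, w t⟫_ℝ 0) ^ 2 / (4 * β))) (Icc 0 T) t) ∧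
      c T = 0 ∧
      -- `v(t,x) = ⟨w(t), x⟩ + c(t)` is an integral solution of the HJB equation
      DelayControl.IsIntegralSolution A (DelayControl.opQ r σ) (DelayControl.hamiltonian B h) φ T
        (fun t x => ⟪w t, x⟫_ℝ + c t) ∧
      -- the open-loop control `z*(t) = ⟨B, w(t)⟩⁺ / (2β)` is optimal, and `v = V`
      ∀ t ∈ Icc 0 T, ∀ x : DelayControl.X r,
        DelayControl.IsOptimal P 𝔽 W Astar B G φ h T t x
          (fun s _ => max ⟪B, w s⟫_ℝ 0 / (2 * β)) ∧
        DelayControl.V P 𝔽 W Astar B G φ h T t x = ((⟪w t, x⟫_ℝ + c t : ℝ) : EReal) := by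
  subst h𝔽 hA hAstar hG hh hφ
  obtain ⟨p, hpc, hpe⟩ := DelayControl.exists_volterra_solution
    (DelayControl.continuous_delayKernel a₀ a₁) hT.le
  have hp : DelayControl.IsFundamental a₀ a₁ T p := ⟨hpc, hpe⟩
  set w := DelayControl.adjointFlow r T γ hp.continuous with hw
  have hwc : Continuous w := DelayControl.continuous_adjointFlow γ hp.continuous
  have hwa := DelayControl.isAdjointSolution_adjointFlow hr hT.le hp γ
  set ℓ : ℝ → ℝ := fun s => (max ⟪B, w s⟫_ℝ 0) ^ 2 / (4 * β) with hℓ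
  have hℓc : Continuous ℓ := by fun_prop
  set c : ℝ → ℝ := fun t => ∫ s in t..T, ℓ s with hc
  have hcd : ∀ t, HasDerivAt c (-ℓ t) t := fun t =>
    intervalIntegral.integral_hasDerivAt_left (hℓc.intervalIntegrable _ _)
      (hℓc.stronglyMeasurableAtFilter _ _) hℓc.continuousAt
  have hcT : c T = 0 := intervalIntegral.integral_same
  have hham : DelayControl.hamiltonian B (fun z => -β * z ^ 2)
      = fun q => (max ⟪B, q⟫_ℝ 0) ^ 2 / (4 * β) := funext (DelayControl.hamiltonian_eq hβ B)
  -- the objective, up to the expected running reward of the control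
  have hJ : ∀ t ∈ Icc 0 T, ∀ x : DelayControl.X r, ∀ z,
      DelayControl.IsAdmissible P (DelayControl.brownianFiltration P W hWm) T z →
      DelayControl.J P (DelayControl.brownianFiltration P W hWm) W (DelayControl.opAstar r a₀ a₁) B
        (DelayControl.opG r σ) (fun x => γ * x.fst) (fun z => -β * z ^ 2) T t x z
        = ⟪w t, x⟫_ℝ
          + ∫ ω, DelayControl.reducedPayoff β (fun τ => ⟪B, w τ⟫_ℝ) z t T ω ∂P := by
    intro t ht x z hz
    obtain ⟨Y, hY, -, hYe⟩ := DelayControl.exists_isWeakSolution hr hp hWm hW σ β γ B x ht hz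
    rw [DelayControl.J_eq_integral_payoff ht hY fun Y' hY' =>
      DelayControl.ae_eq_of_isWeakSolution hr ht hz hY hY', hYe]
  have hstar : DelayControl.IsAdmissible P (DelayControl.brownianFiltration P W hWm) T
      (fun s _ => max ⟪B, w s⟫_ℝ 0 / (2 * β)) :=
    DelayControl.isAdmissible_of_continuous (by fun_prop) fun s =>
      div_nonneg (le_max_right _ _) (by positivity)
  have hJstar : ∀ t ∈ Icc 0 T, ∀ x : DelayControl.X r,
      DelayControl.J P (DelayControl.brownianFiltration P W hWm) W (DelayControl.opAstar r a₀ a₁) B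
        (DelayControl.opG r σ) (fun x => γ * x.fst) (fun z => -β * z ^ 2) T t x
        (fun s _ => max ⟪B, w s⟫_ℝ 0 / (2 * β)) = ⟪w t, x⟫_ℝ + c t := by
    intro t ht x
    rw [hJ t ht x _ hstar]
    simp_rw [DelayControl.reducedPayoff_maximizer hβ (fun τ => ⟪B, w τ⟫_ℝ)]
    simp [hc, hℓ]
  have hV : ∀ t ∈ Icc 0 T, ∀ x : DelayControl.X r,
      DelayControl.V P (DelayControl.brownianFiltration P W hWm) W (DelayControl.opAstar r a₀ a₁) B
        (DelayControl.opG r σ) (fun x => γ * x.fst) (fun z => -β * z ^ 2) T t x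
        = ((⟪w t, x⟫_ℝ + c t : ℝ) : EReal) := by
    intro t ht x
    refine le_antisymm (iSup₂_le fun z hz => ?_) ?_
    · rw [hJ t ht x z hz, EReal.coe_le_coe_iff]
      exact add_le_add_right (hz.integral_reducedPayoff_le hβ (by fun_prop) ht) _
    · rw [← hJstar t ht x]
      exact le_iSup₂_of_le _ hstar le_rfl
  refine ⟨fun q => ⟨DelayControl.hamiltonian_eq hβ B q,
    DelayControl.isGreatest_hamiltonianValues hβ B q⟩, fun t ht x z hz => ?_, w, c, hwa, ?_,
    fun t ht => DelayControl.hasDerivWithinAt_fst_adjointFlow hr hp γ ht,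
    fun t _ => DelayControl.snd_adjointFlow_ae hp.continuous γ t,
    fun t _ => (hcd t).hasDerivWithinAt, hcT, ?_, fun t ht x => ⟨⟨hstar, ?_⟩, hV t ht x⟩⟩
  · obtain ⟨Y, hY, hYi, -⟩ := DelayControl.exists_isWeakSolution hr hp hWm hW σ β γ B x ht hz
    exact ⟨Y, hY, hYi, fun Y' hY' => DelayControl.ae_eq_of_isWeakSolution hr ht hz hY hY'⟩
  · intro w' hw'
    refine hwa.eqOn hw' (C := |a₀| + 1 / 2 + ‖a₁‖) ?_ ?_ hT.le
    · rw [DelayControl.opA_graph hr]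
      exact fun m d h => DelayControl.inner_le_of_mem_graphAstar hr.le
        (DelayControl.mem_graphAstar_of_inner_eq hr.le h)
    · rw [DelayControl.opA_graph hr]
      exact fun d h => DelayControl.eq_zero_of_inner_graphA hr h
  · refine DelayControl.isIntegralSolution_affine hwa (fun x => ?_) ?_ (fun t _ => ?_) hcT
    · rw [DelayControl.X.inner_eq]
      simp
    · rw [hham]
      fun_prop
    · rw [hham]
      exact (hcd t).hasDerivWithinAt
  · rw [hV t ht x, hJstar t ht x]
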